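/- \textbf{Setting.} Let $\beta\ge\sqrt2$, $\alpha=\arcsin\frac1{2\beta}$ and $c_{gbu}=(2\beta)^{\pi/\alpha}$. For distinct points $p,q$ of a finite vertex set $P\subset B=[0,1]^2$, the left (right) \emph{leaf} of $pq$ is the closed disk of radius $\beta|pq|$ through $p$ and $q$ with center to the left (right) of $pq$. The pair $p,q$ is \emph{loose} if one of its two leaves contains no vertex other than $p,q$; a leaf on a side of the line $pq$ that misses $B$ is not considered. Given an empty leaf, let $c$ be the point of its boundary furthest from $pq$; the \emph{crescent} is the disk centered at $c$ with $p,q$ on its boundary, minus the leaf. A \emph{moonstruck} point of the loose pair is a vertex $w$ in the crescent such that the circumdisk of $pqw$ has no vertex in its interior. The \emph{off-center} is $c$ if the crescent contains no vertex, and otherwise the circumcenter of $pqw$ with $w$ moonstruck. For a vertex $p$, $\mathrm{lfs}_P(p)$ is the distance to the nearest other vertex. \textbf{Algorithm.} The input is a finite set $\Omega\subset[1/3,2/3]^2$. Initially $P$ consists of $\Omega$ and the 12 points that split each side of $B$ into three. Let $T$ be a finite balanced quadtree with root $B$, and let $0<c_{low}$, $2c_{low}\le c_{up}$ be constants such that $c_{low}\,\mathrm{size}(\Box)\le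 \mathrm{lfs}_P(p)\le c_{up}\,\mathrm{size}(\Box)$ for each leaf $\Box$ of $T$ and each initial vertex $p\in\Box$; let $c_{reach}=2c_{up}c_{gbu}$. All nodes are put into a heap, and smallest nodes are extracted until the heap is empty. An extracted node $\Box$ is handled as follows: while there is a loose pair $p,q$ of active vertices with $p\in\Box$ and $|pq|\le c_{reach}\,\mathrm{size}(\Box)$, take an off-center $r$ of such a pair. If $r$ lies inside the diametral circle of no boundary edge, insert $r$ into $P$; otherwise insert, instead of $r$, the midpoints of all boundary edges whose diametral circle contains $r$. A new vertex at distance $\delta$ from the nearest old vertex is stored in the smallest node $\Box'$ of $T$ containing it with $c_{low}\,\mathrm{size}(\Box')\le\delta\le c_{up}\,\mathrm{size}(\Box')$ and $\mathrm{size}(\Box')\ge\mathrm{size}(\Box)$; if $\Box'$ has the same depth as $\Box$, it is put back into the heap. The \emph{activation depth} $\mathrm{act}(p)$ is the depth of the initial leaf containing $p$ if $p$ is an initial vertex, and the depth of the cell $p$ is inserted into otherwise. \textbf{Claim.} Let $c_{shrink}\in(0,1]$ (for instance the constant for which $\mathrm{lfs}_{F}\ge c_{shrink}\,\mathrm{lfs}_{\Omega}$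 holds for the final vertex set $F$), $c'_{low}=c_{shrink}c_{low}$ and $$c_{span}=\lg\frac{c_{gbu}\,c_{up}}{c'_{low}}+1 .$$ Suppose that every vertex $p$ is regarded as active at least while cells of depth $\ge \mathrm{act}(p)-c_{span}$ are handled (it may be active always, or be deactivated afterwards). Then at every moment of every run at which the algorithm handles a cell of depth $m$, no vertex $p\in P$ with $m<\mathrm{act}(p)-c_{span}$ is an endpoint of a loose pair or a moonstruck point of a loose pair. -/

import Mathlib

open Set Metric

noncomputable section

namespace DelaunayRefinement

/-! ### Planar geometry: flowers, loose pairs, crescents, off-centers -/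

/-- The Euclidean plane. -/
abbrev Plane := EuclideanSpace ℝ (Fin 2)

/-- Twice the signed area of the triangle `p q x`; it is positive iff `p q x` is a left turn. -/
def orient (p q x : Plane) : ℝ :=
  (q 0 - p 0) * (x 1 - p 1) - (q 1 - p 1) * (x 0 - p 0)

/-- Rotation by a right angle, counterclockwise. -/
def rot (v : Plane) : Plane := !₂[-(v 1), v 0]

/-- The domain square `B = [0,1]²`. -/
def unitSquare : Set Plane := {x | ∀ i, x i ∈ Icc (0 : ℝ) 1}

/-- The center of the left leaf of the flower of `p q`: the point `u` at distance `β |pq|` from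
`p` and `q` such that `p q u` is a left turn. -/
def leafCenter (β : ℝ) (p q : Plane) : Plane :=
  midpoint ℝ p q + √(β ^ 2 - 1 / 4) • rot (q - p)

/-- The left leaf (a closed disk) of the flower of `p q`. The right leaf of `p q` is the left leaf
of `q p`, so everything below is stated for left leaves of ordered pairs. -/
def leftLeaf (β : ℝ) (p q : Plane) : Set Plane :=
  closedBall (leafCenter β p q) (β * dist p q)

/-- The left side of the line `p q` contains a part of the domain. For `p, q` in the square this
fails only if `p` and `q` lie on one side of the square, with the exterior on their left. -/
def FacesDomain (p q : Plane) : Prop := ∃ x ∈ unitSquare, 0 < orient p q x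

/-- `p q` is loose due to its left leaf: this leaf contains no vertex besides `p` and `q`.
Leaves pointing to the outside of the domain square are not considered. -/
def IsLeftLoose (β : ℝ) (P : Set Plane) (p q : Plane) : Prop :=
  p ∈ P ∧ q ∈ P ∧ p ≠ q ∧ FacesDomain p q ∧ ∀ x ∈ P, x ∈ leftLeaf β p q → x = p ∨ x = q

/-- `p, q` is a loose pair: the left or the right leaf of its flower is empty of vertices. -/
def IsLoosePair (β : ℝ) (P : Set Plane) (p q : Plane) : Prop :=
  IsLeftLoose β P p q ∨ IsLeftLoose β P q p

/-- The point of the boundary of the left leaf of `p q` that is furthest from `p q`. -/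
def leafApex (β : ℝ) (p q : Plane) : Plane :=
  midpoint ℝ p q + (β + √(β ^ 2 - 1 / 4)) • rot (q - p)

/-- The left crescent: the disk centered at the apex of the left leaf with `p` and `q` on its
boundary, minus the left leaf. -/
def leftCrescent (β : ℝ) (p q : Plane) : Set Plane :=
  closedBall (leafApex β p q) (dist (leafApex β p q) p) \ leftLeaf β p q

/-- `o` is the center of a circle through `p`, `q`, `w`. -/
def IsCircumcenter (o p q w : Plane) : Prop := dist o p = dist o q ∧ dist o p = dist o w

/-- `w` is the moonstruck point of `p q`, loose due to its left leaf, with circumcenter `o` of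
`p q w`: `w` is a vertex in the left crescent and the circumdisk of `p q w` has no vertex in
its interior. -/
def IsLeftMoonstruckAt (β : ℝ) (P : Set Plane) (p q w o : Plane) : Prop :=
  IsLeftLoose β P p q ∧ w ∈ P ∧ w ∈ leftCrescent β p q ∧ IsCircumcenter o p q w ∧
    ∀ x ∈ P, x ∉ ball o (dist o p)

/-- `w` is a moonstruck point of the loose pair `p, q` (on either side). -/
def IsMoonstruck (β : ℝ) (P : Set Plane) (p q w : Plane) : Prop :=
  ∃ o, IsLeftMoonstruckAt β P p q w o ∨ IsLeftMoonstruckAt β P q p w o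

/-- `r` is the off-center of `p q`, loose due to its left leaf: the apex of the leaf if the
crescent contains no vertex, and otherwise the circumcenter of `p`, `q` and the moonstruck
point. -/
def IsLeftOffCenter (β : ℝ) (P : Set Plane) (p q r : Plane) : Prop :=
  (IsLeftLoose β P p q ∧ (∀ x ∈ P, x ∉ leftCrescent β p q) ∧ r = leafApex β p q) ∨
    ∃ w, IsLeftMoonstruckAt β P p q w r

/-- `r` is an off-center of the loose pair `p, q`. -/
def IsOffCenter (β : ℝ) (P : Set Plane) (p q r : Plane) : Prop :=
  IsLeftOffCenter β P p q r ∨ IsLeftOffCenter β P q p r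

/-- The local feature size of `x` with respect to the vertex set `P`: the radius of the smallest
disk centered at `x` that touches two vertices. For a vertex this is the distance to the nearest
other vertex. -/
def lfs (P : Set Plane) (x : Plane) : ℝ :=
  sInf {ρ : ℝ | 0 ≤ ρ ∧ 2 ≤ (P ∩ closedBall x ρ).encard}

/-! ### The boundary of the domain -/

/-- The vertices obtained by splitting each side of the unit square into three. -/
def boundaryVertices : Set Plane :=
  {x | (∃ i, x i = 0 ∨ x i = 1) ∧ ∀ i, x i ∈ ({0, 1 / 3, 2 / 3, 1} : Set ℝ)}

/-- The vertices present initially: the input points and the vertices on the square. -/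
def initialVertices (Ω : Set Plane) : Set Plane := Ω ∪ boundaryVertices

/-- `a b` is a boundary edge: `a`, `b` are consecutive vertices on one side of the square. -/
def IsBoundaryEdge (P : Set Plane) (a b : Plane) : Prop :=
  a ∈ P ∧ b ∈ P ∧ a ≠ b ∧ (∃ i, (a i = 0 ∧ b i = 0) ∨ (a i = 1 ∧ b i = 1)) ∧
    ∀ x ∈ P, x ∉ openSegment ℝ a b

/-- `r` lies inside the diametral circle of the segment `a b`. -/
def Encroaches (r a b : Plane) : Prop := dist r (midpoint ℝ a b) < dist a b / 2

/-- The midpoints of the boundary edges encroached by `r`. -/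
def encroachedMidpoints (P : Set Plane) (r : Plane) : Set Plane :=
  {x | ∃ a b, IsBoundaryEdge P a b ∧ Encroaches r a b ∧ x = midpoint ℝ a b}

/-! ### Quadtrees -/

/-- A dyadic square: with `h = 2 ^ (-depth)`, its lower left corner is
`(idx 0 * h, idx 1 * h)` and its side length is `h`. -/
@[ext]
structure Cell where
  depth : ℕ
  idx : Fin 2 → ℕ

/-- The side length of a cell. -/
def Cell.size (C : Cell) : ℝ := (1 / 2) ^ C.depth

/-- The points belonging to a cell. Cells are half-open, except along the upper and the right
side of the unit square, so that the cells of each depth partition the unit square. -/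
def Cell.points (C : Cell) : Set Plane :=
  {x | ∀ i, C.idx i * C.size ≤ x i ∧
    (x i < (C.idx i + 1) * C.size ∨ (C.idx i + 1 = 2 ^ C.depth ∧ x i = 1))}

/-- The closed square of a cell. -/
def Cell.square (C : Cell) : Set Plane :=
  {x | ∀ i, x i ∈ Icc (C.idx i * C.size) ((C.idx i + 1) * C.size)}

/-- The unit square as a cell. -/
def Cell.root : Cell := ⟨0, fun _ => 0⟩

/-- The four children of a cell. -/
def Cell.child (C : Cell) (b : Fin 2 → Fin 2) : Cell :=
  ⟨C.depth + 1, fun i => 2 * C.idx i + (b i : ℕ)⟩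

/-- A finite quadtree with the unit square as its root: each node has no child or four. -/
structure Quadtree where
  nodes : Set Cell
  finite_nodes : nodes.Finite
  root_mem : Cell.root ∈ nodes
  has_parent : ∀ C ∈ nodes, C = Cell.root ∨ ∃ D ∈ nodes, ∃ b, C = D.child b
  siblings : ∀ C : Cell, ∀ b b' : Fin 2 → Fin 2, C.child b ∈ nodes → C.child b' ∈ nodes

/-- The leaves of a quadtree. -/
def Quadtree.IsLeaf (T : Quadtree) (C : Cell) : Prop :=
  C ∈ T.nodes ∧ ∀ b, C.child b ∉ T.nodes

/-- Leaves that share more than one point (hence a part of a side) have the same size up to a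
factor of two. -/
def Quadtree.Balanced (T : Quadtree) : Prop :=
  ∀ C D, T.IsLeaf C → T.IsLeaf D → (C.square ∩ D.square).Nontrivial → C.size ≤ 2 * D.size

/-- The leaf sizes approximate the local feature sizes of the vertices `P` in the leaves. -/
def Quadtree.Approximates (T : Quadtree) (P : Set Plane) (cLow cUp : ℝ) : Prop :=
  ∀ C, T.IsLeaf C → ∀ p ∈ P ∩ C.points, cLow * C.size ≤ lfs P p ∧ lfs P p ≤ cUp * C.size

/-! ### Constants -/

/-- The small angle threshold `α = arcsin (1 / (2 β))`. -/
def smallAngle (β : ℝ) : ℝ := Real.arcsin (1 / (2 * β))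

/-- `c_gbu = (2 β) ^ (π / α)`. -/
def cGbu (β : ℝ) : ℝ := (2 * β) ^ (Real.pi / smallAngle β)

/-- `c_reach = 2 c_up c_gbu`. -/
def cReach (β cUp : ℝ) : ℝ := 2 * cUp * cGbu β

/-- `c_span = lg (c_gbu c_up / c'_low) + 1`, where `c'_low = c_shrink c_low`. -/
def cSpan (β cLow cUp cShrink : ℝ) : ℝ :=
  Real.logb 2 (cGbu β * cUp / (cShrink * cLow)) + 1

/-! ### The refinement algorithm -/

/-- The data on which a run of the algorithm depends. `Active a i` says that vertices of
activation depth `a` are regarded as active while cells of depth `i` are handled. -/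
structure Setup where
  β : ℝ
  cLow : ℝ
  cUp : ℝ
  tree : Quadtree
  Active : ℕ → ℕ → Prop

/-- A state of the algorithm: the current vertices, the cell in which each vertex is stored (only
its values at vertices matter), the heap of quadtree nodes, and the node being handled. -/
structure RunState where
  P : Set Plane
  loc : Plane → Cell
  heap : Set Cell
  cur : Cell

/-- The activation depth of a vertex: the depth of the initial leaf containing it for an initial
vertex, and the depth of the cell it was inserted into for a later one. -/
def RunState.act (s : RunState) (p : Plane) : ℕ := (s.loc p).depth

/-- `C` is a quadtree node which contains `x`, is at least as large as `D`, and has size comparable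
to `δ`. -/
def Setup.Admissible (S : Setup) (D : Cell) (x : Plane) (δ : ℝ) (C : Cell) : Prop :=
  C ∈ S.tree.nodes ∧ x ∈ C.points ∧ S.cLow * C.size ≤ δ ∧ δ ≤ S.cUp * C.size ∧ D.size ≤ C.size

/-- `C` is the lowest admissible node. -/
def Setup.IsStorageCell (S : Setup) (D : Cell) (x : Plane) (δ : ℝ) (C : Cell) : Prop :=
  S.Admissible D x δ C ∧ ∀ C', S.Admissible D x δ C' → C.size ≤ C'.size

/-- `p, q` is a loose pair of active vertices found when the current node is handled. -/
def Setup.IsCandidate (S : Setup) (s : RunState) (p q : Plane) : Prop :=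
  p ∈ s.P ∧ p ∈ s.cur.points ∧ S.Active (s.act p) s.cur.depth ∧
  q ∈ s.P ∧ S.Active (s.act q) s.cur.depth ∧
  dist p q ≤ cReach S.β S.cUp * s.cur.size ∧ IsLoosePair S.β s.P p q

/-- `t` arises from `s` by adding the vertices `N`, where `x ∈ N` is stored according to the length
`δ x`; nodes on the current level that receive a vertex are put back into the heap. -/
def Setup.Adds (S : Setup) (s t : RunState) (N : Set Plane) (δ : Plane → ℝ) : Prop :=
  t.P = s.P ∪ N ∧ (∀ x ∈ s.P, t.loc x = s.loc x) ∧
  (∀ x ∈ N, S.IsStorageCell s.cur x (δ x) (t.loc x)) ∧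
  t.heap = s.heap ∪ {C | C.depth = s.cur.depth ∧ ∃ x ∈ N, t.loc x = C} ∧
  t.cur = s.cur

/-- One step of the algorithm. -/
inductive Setup.Step (S : Setup) : RunState → RunState → Prop
  /-- The off-center `r` of a loose pair encroaches no boundary edge, and is inserted. -/
  | insert (s t : RunState) (p q r : Plane) (hpq : S.IsCandidate s p q)
      (hr : IsOffCenter S.β s.P p q r) (he : encroachedMidpoints s.P r = ∅)
      (ht : S.Adds s t {r} fun _ => dist p r) : Setup.Step S s t
  /-- The off-center `r` of a loose pair encroaches some boundary edges; it is not inserted, and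
  these edges are split in the middle. A midpoint is stored according to its distance to the
  nearest vertex, as is an off-center, whose nearest vertices are `p` and `q`. -/
  | split (s t : RunState) (p q r : Plane) (hpq : S.IsCandidate s p q)
      (hr : IsOffCenter S.β s.P p q r) (he : (encroachedMidpoints s.P r).Nonempty)
      (ht : S.Adds s t (encroachedMidpoints s.P r) fun x => infDist x s.P) : Setup.Step S s t
  /-- The current node has been dealt with, and a smallest node is extracted from the heap. -/
  | extract (s : RunState) (C : Cell) (hdone : ∀ p q, ¬ S.IsCandidate s p q)
      (hC : C ∈ s.heap) (hmin : ∀ D ∈ s.heap, C.size ≤ D.size) :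
      Setup.Step S s ⟨s.P, s.loc, s.heap \ {C}, C⟩

/-- The state after a smallest node has been extracted from the initial heap, which holds all
the nodes: each initial vertex is stored in the leaf containing it. -/
def Setup.IsInitial (S : Setup) (Ω : Set Plane) (s : RunState) : Prop :=
  s.P = initialVertices Ω ∧
  (∀ p ∈ s.P, S.tree.IsLeaf (s.loc p) ∧ p ∈ (s.loc p).points) ∧
  s.cur ∈ S.tree.nodes ∧ (∀ D ∈ S.tree.nodes, s.cur.size ≤ D.size) ∧
  s.heap = S.tree.nodes \ {s.cur}

/-- The states that occur in some run of the algorithm on the input `Ω`. In such a state the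
algorithm handles the level of depth `s.cur.depth`. -/
def Setup.Reachable (S : Setup) (Ω : Set Plane) (s : RunState) : Prop :=
  ∃ s₀, S.IsInitial Ω s₀ ∧ Relation.ReflTransGen S.Step s₀ s

end DelaunayRefinement

end

/-! The argument has a geometric half and an algorithmic half.

Geometry. Let `p` have nearest vertex `a`, and suppose that every loose pair is longer than `cGbu β
* dist p a`. Then every Delaunay neighbor `q` of `p` satisfies `dist p q ≤ cGbu β * dist p a`
(`dist_le_cGbu_mul`). First, a shortest half-loose pair is loose, so half-loose pairs are long as
well (`IsHalfLoose.exists_isLeftLoose`). Hence a Delaunay triangle with a short edge has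
circumradius at most `β` times each of its edges (`circumradius_le`): its angles are at least `α`,
and its edges at `p` differ by a factor of at most `2β`. Rotating from `p a` to `p q` through
Delaunay triangles costs an angle of at most `π`, so the length grows by at most `(2β)^(π/α)`
(`dist_le_rpow_turn_mul`). Endpoints of a loose pair are Delaunay neighbors, and a moonstruck point
is a Delaunay neighbor of both endpoints. So if `p` has a vertex within `d` and all loose pairs are
longer than `2 * cGbu β * d`, then `p` plays neither role.

Algorithm. `Setup.Invariant` says that while a cell of size `σ` is handled, loose pairs have length
at least `cLow * σ`, and that those shorter than twice this bound have an endpoint in a pending cell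
of the current depth. A vertex `p` has another vertex within `d = cUp * (s.loc p).size`. If `p` is
more than `cSpan` levels deeper than the current cell, then `2 * cGbu β * d < cLow * σ`, and the
geometric half applies. There is no circularity in preserving the invariant: the claim for a given
state shows that endpoints of its loose pairs are active, so finishing a cell really removes the
short loose pairs there (`Setup.Invariant.not_mem_cur`). -/

noncomputable section

namespace DelaunayRefinement

/-! ### Coordinates and circles through a chord -/

lemma dist_sq_eq (x y : Plane) : dist x y ^ 2 = (x 0 - y 0) ^ 2 + (x 1 - y 1) ^ 2 := by
  rw [EuclideanSpace.dist_eq, Real.sq_sqrt (Finset.sum_nonneg fun _ _ => sq_nonneg _),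
    Fin.sum_univ_two, Real.dist_eq, Real.dist_eq, sq_abs, sq_abs]

lemma plane_ext {x y : Plane} (h0 : x 0 = y 0) (h1 : x 1 = y 1) : x = y := by
  ext i; fin_cases i <;> assumption

/-- The inner product of `x - u` and `y - v`. -/
def dot (u x v y : Plane) : ℝ := (x 0 - u 0) * (y 0 - v 0) + (x 1 - u 1) * (y 1 - v 1)

/-- The power of `x` with respect to the circle through `u` and `v` whose center is
`midpoint u v + t • rot (v - u)`. -/
def chordPower (t : ℝ) (u v x : Plane) : ℝ := dot u x v x - 2 * t * orient u v x

/-- The center of the circle through `u` and `v` at signed relative height `t` over the chord. -/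
def chordCenter (t : ℝ) (u v : Plane) : Plane := midpoint ℝ u v + t • rot (v - u)

lemma chordCenter_zero (t : ℝ) (u v : Plane) :
    chordCenter t u v 0 = (u 0 + v 0) / 2 - t * (v 1 - u 1) := by
  simp [chordCenter, rot, midpoint_eq_smul_add]; ring

lemma chordCenter_one (t : ℝ) (u v : Plane) :
    chordCenter t u v 1 = (u 1 + v 1) / 2 + t * (v 0 - u 0) := by
  simp [chordCenter, rot, midpoint_eq_smul_add]; ring

lemma dist_chordCenter_left_sq (t : ℝ) (u v : Plane) :
    dist (chordCenter t u v) u ^ 2 = (t ^ 2 + 1 / 4) * dist u v ^ 2 := by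
  rw [dist_sq_eq, dist_sq_eq, chordCenter_zero, chordCenter_one]; ring

lemma dist_chordCenter_right_sq (t : ℝ) (u v : Plane) :
    dist (chordCenter t u v) v ^ 2 = (t ^ 2 + 1 / 4) * dist u v ^ 2 := by
  rw [dist_sq_eq, dist_sq_eq, chordCenter_zero, chordCenter_one]; ring

lemma dist_chordCenter_sq (t : ℝ) (u v x : Plane) :
    dist (chordCenter t u v) x ^ 2 = (t ^ 2 + 1 / 4) * dist u v ^ 2 + chordPower t u v x := by
  rw [dist_sq_eq, dist_sq_eq, chordCenter_zero, chordCenter_one, chordPower, dot, orient]; ring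

/-- Every circle through `u` and `v` is of the form above. -/
lemma exists_chordCenter_eq {o u v : Plane} (huv : u ≠ v) (h : dist o u = dist o v) :
    ∃ t, o = chordCenter t u v := by
  have hpos : 0 < dist u v ^ 2 := by have := dist_pos.2 huv; positivity
  have h2 : dist o u ^ 2 = dist o v ^ 2 := by rw [h]
  rw [dist_sq_eq] at hpos
  rw [dist_sq_eq, dist_sq_eq] at h2
  have hne := hpos.ne'
  refine ⟨orient u v o / ((u 0 - v 0) ^ 2 + (u 1 - v 1) ^ 2), plane_ext ?_ ?_⟩
  · rw [chordCenter_zero, orient]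
    field_simp
    linear_combination (v 0 - u 0) * h2
  · rw [chordCenter_one, orient]
    field_simp
    linear_combination (v 1 - u 1) * h2

/-! ### Leaves as circles of fixed relative height -/

lemma one_lt_of_sqrt_two_le {β : ℝ} (hβ : √2 ≤ β) : 1 < β :=
  lt_of_lt_of_le (by rw [Real.lt_sqrt] <;> norm_num) hβ

/-- The relative height of the center of a leaf over its chord. -/
def leafHeight (β : ℝ) : ℝ := √(β ^ 2 - 1 / 4)

lemma leafHeight_nonneg (β : ℝ) : 0 ≤ leafHeight β := Real.sqrt_nonneg _

lemma leafHeight_sq {β : ℝ} (hβ : 1 < β) : leafHeight β ^ 2 + 1 / 4 = β ^ 2 := by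
  rw [leafHeight, Real.sq_sqrt (by nlinarith)]; ring

lemma dist_leafCenter {β : ℝ} (hβ : 1 < β) (u v : Plane) :
    dist (leafCenter β u v) u = β * dist u v := by
  have h := dist_chordCenter_left_sq (leafHeight β) u v
  rw [leafHeight_sq hβ, ← mul_pow] at h
  exact (sq_eq_sq₀ dist_nonneg (by positivity)).1 h

lemma dist_leafCenter' {β : ℝ} (hβ : 1 < β) (u v : Plane) :
    dist (leafCenter β u v) v = β * dist u v := by
  have h := dist_chordCenter_right_sq (leafHeight β) u v
  rw [leafHeight_sq hβ, ← mul_pow] at h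
  exact (sq_eq_sq₀ dist_nonneg (by positivity)).1 h

lemma mem_leftLeaf {β : ℝ} (hβ : 1 < β) (u v x : Plane) :
    x ∈ leftLeaf β u v ↔ chordPower (leafHeight β) u v x ≤ 0 := by
  have h := dist_chordCenter_sq (leafHeight β) u v x
  rw [leafHeight_sq hβ, ← mul_pow] at h
  rw [leftLeaf, mem_closedBall, dist_comm, ← sq_le_sq₀ dist_nonneg (by positivity)]
  change dist (chordCenter (leafHeight β) u v) x ^ 2 ≤ _ ↔ _
  rw [h]; constructor <;> intro h <;> linarith

/-! ### Half-loose pairs and reduction to loose pairs -/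

/-- The part of the left leaf of `u v` strictly to the left of the line `u v` has no vertex. -/
def IsHalfLoose (β : ℝ) (P : Set Plane) (u v : Plane) : Prop :=
  u ∈ P ∧ v ∈ P ∧ u ≠ v ∧ FacesDomain u v ∧
    ∀ x ∈ P, 0 < orient u v x → 0 < chordPower (leafHeight β) u v x

lemma dot_self_pos {u y : Plane} (h : u ≠ y) : 0 < dot u y u y := by
  have : dot u y u y = dist u y ^ 2 := by rw [dist_sq_eq, dot]; ring
  rw [this]; have := dist_pos.2 h; positivity

/-- Below the chord, the left leaf of `u v` lies inside the diametral disk. -/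
lemma dot_nonpos_of_mem_leaf {t : ℝ} (ht : 0 ≤ t) {u v y : Plane} (hy : chordPower t u v y ≤ 0)
    (ho : orient u v y ≤ 0) : dot u y v y ≤ 0 := by
  have : 0 ≤ t * -orient u v y := mul_nonneg ht (by linarith)
  rw [chordPower] at hy; linarith

lemma dot_pos_of_mem_leaf {t : ℝ} (ht : 0 ≤ t) {u v y : Plane} (hy : chordPower t u v y ≤ 0)
    (ho : orient u v y ≤ 0) (hne : u ≠ y) : 0 < dot u y u v := by
  have h1 := dot_nonpos_of_mem_leaf ht hy ho
  have h2 := dot_self_pos hne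
  simp only [dot] at *; linarith

/-- Compares directions: where the inner products with `v - u` are positive, the sign of `orient u y
x` tells which of `x`, `y` has the larger slope `orient / dot` relative to `u v`. -/
lemma orient_mul_dot (u v y x : Plane) :
    orient u y x * dot u v u v = dot u y u v * orient u v x - orient u v y * dot u x u v := by
  simp only [dot, orient]; ring

lemma orient_swap (u v x : Plane) : orient v u x = -orient u v x := by
  simp only [orient]; ring

lemma orient_swap_right (u v x : Plane) : orient u x v = -orient u v x := by
  simp only [orient]; ring

lemma orient_rotate (u v x : Plane) : orient v x u = orient u v x := by
  simp only [orient]; ring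

/-- If `y` lies in the left leaf of `u v`, below the chord, then the part of the left leaf
of `u y` to the left of `u y` is contained in the left leaf of `u v`. -/
lemma chordPower_le_of_mem_leaf {t : ℝ} {u v y x : Plane} (hne : u ≠ y)
    (hy : chordPower t u v y ≤ 0) (ho : orient u v y ≤ 0) (hx : chordPower t u y x ≤ 0)
    (hox : 0 < orient u y x) :
    chordPower t u v x ≤ 0 ∧ (orient u v y < 0 → chordPower t u v x < 0) := by
  -- The difference of the two powers is affine in `x` and vanishes at `u`. This expansion makes
  -- both summands on the right nonpositive.
  have key : dot u y u y * (chordPower t u v x - chordPower t u y x) =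
      (dot u x u x - chordPower t u y x) * chordPower t u v y +
        orient u y x * ((1 + 4 * t ^ 2) * orient u v y) := by
    simp only [chordPower, dot, orient]; ring
  have h2 := dot_self_pos hne
  have h3 : 0 ≤ dot u x u x := by simp only [dot]; nlinarith [sq_nonneg (x 0 - u 0), sq_nonneg (x 1 - u 1)]
  have h4 : (dot u x u x - chordPower t u y x) * chordPower t u v y ≤ 0 :=
    mul_nonpos_of_nonneg_of_nonpos (by linarith) hy
  have ht : 0 < 1 + 4 * t ^ 2 := by positivity
  constructor
  · have h5 : orient u y x * ((1 + 4 * t ^ 2) * orient u v y) ≤ 0 :=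
      mul_nonpos_of_nonneg_of_nonpos hox.le (mul_nonpos_of_nonneg_of_nonpos ht.le ho)
    by_contra! hc
    have := mul_pos h2 (by linarith : 0 < chordPower t u v x - chordPower t u y x)
    linarith
  · intro hlt
    have h5 : orient u y x * ((1 + 4 * t ^ 2) * orient u v y) < 0 :=
      mul_neg_of_pos_of_neg hox (mul_neg_of_pos_of_neg ht hlt)
    by_contra! hc
    have := mul_nonneg h2.le (by linarith : 0 ≤ chordPower t u v x - chordPower t u y x)
    linarith

lemma chordPower_right (t : ℝ) (u v : Plane) : chordPower t u v v = 0 := by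
  simp only [chordPower, dot, orient]; ring

lemma dist_lt_of_mem_leaf {t : ℝ} (ht : 0 ≤ t) {u v y : Plane} (hy : chordPower t u v y ≤ 0)
    (ho : orient u v y ≤ 0) (hne : v ≠ y) : dist u y < dist u v := by
  have h1 := dot_nonpos_of_mem_leaf ht hy ho
  have h2 := dot_self_pos hne
  refine lt_of_pow_lt_pow_left₀ 2 dist_nonneg ?_
  rw [dist_sq_eq, dist_sq_eq]
  simp only [dot] at h1 h2
  linarith

/-- If `y` is strictly to the right of `u v`, then `v` itself is to the left of `u y`. Otherwise `y`
is on the ray from `u` through `v`, and the old witness serves. -/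
lemma FacesDomain.of_mem_leaf {u v y : Plane} (hv : v ∈ unitSquare) (hface : FacesDomain u v)
    (huv : u ≠ v) (hd : 0 < dot u y u v) (ho : orient u v y ≤ 0) : FacesDomain u y := by
  rcases ho.lt_or_eq with hlt | heq
  · exact ⟨v, hv, by rw [orient_swap_right]; linarith⟩
  · obtain ⟨w, hw, hwo⟩ := hface
    refine ⟨w, hw, ?_⟩
    have h3 := orient_mul_dot u v y w
    rw [heq, zero_mul, sub_zero] at h3
    exact pos_of_mul_pos_left (h3 ▸ mul_pos hd hwo) (dot_self_pos huv).le

/-- A half-loose pair that is not loose gives rise to a shorter half-loose pair. -/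
lemma IsHalfLoose.exists_shorter {β : ℝ} (hβ : 1 < β) {P : Set Plane} (hfin : P.Finite)
    (hsq : P ⊆ unitSquare) {a b : Plane} (h : IsHalfLoose β P a b) (hl : ¬ IsLeftLoose β P a b) :
    ∃ y, IsHalfLoose β P a y ∧ dist a y < dist a b := by
  obtain ⟨ha, hb, hne, hface, hempty⟩ := h
  have hτ := leafHeight_nonneg β
  have hl' : ¬ ∀ x ∈ P, x ∈ leftLeaf β a b → x = a ∨ x = b :=
    fun h => hl ⟨ha, hb, hne, hface, h⟩
  push Not at hl'
  obtain ⟨z, hzP, hz, hza, hzb⟩ := hl'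
  rw [mem_leftLeaf hβ] at hz
  have hzo : orient a b z ≤ 0 := not_lt.1 fun hc => absurd hz (not_le.2 (hempty z hzP hc))
  -- Among the vertices in the lower part of the leaf, `y` has the direction from `a` closest to `a
  -- b`. A vertex in the left part of the leaf of `a y` would again lie in the lower part of the
  -- leaf of `a b`, with a larger slope.
  obtain ⟨y, ⟨hyP, hy, hya, hyb, hyo⟩, hymax⟩ := exists_max_image
    {x | x ∈ P ∧ chordPower (leafHeight β) a b x ≤ 0 ∧ x ≠ a ∧ x ≠ b ∧ orient a b x ≤ 0}
    (fun x => orient a b x / dot a x a b) (hfin.subset fun x hx => hx.1)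
    ⟨z, hzP, hz, hza, hzb, hzo⟩
  have hyd := dot_pos_of_mem_leaf hτ hy hyo (Ne.symm hya)
  have habpos := dot_self_pos hne
  refine ⟨y, ⟨ha, hyP, Ne.symm hya, hface.of_mem_leaf (hsq hb) hne hyd hyo, fun x hx hxo => ?_⟩,
    dist_lt_of_mem_leaf hτ hy hyo (Ne.symm hyb)⟩
  by_contra! hc
  obtain ⟨h1, h2⟩ := chordPower_le_of_mem_leaf (Ne.symm hya) hy hyo hc hxo
  have h3 := orient_mul_dot a b y x
  have h3p := mul_pos hxo habpos
  have hxa : x ≠ a := by rintro rfl; simp [orient] at hxo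
  have hxb : x ≠ b := by
    rintro rfl
    rw [orient_swap_right] at hxo
    have := h2 (by linarith)
    rw [chordPower_right] at this
    exact lt_irrefl _ this
  have hxo' : orient a b x ≤ 0 := not_lt.1 fun hc => absurd h1 (not_le.2 (hempty x hx hc))
  have hxd := dot_pos_of_mem_leaf hτ h1 hxo' (Ne.symm hxa)
  have := hymax x ⟨hx, h1, hxa, hxb, hxo'⟩
  rw [div_le_div_iff₀ hxd hyd] at this
  linarith

/-- A half-loose pair bounds the length of a shortest loose pair. -/
lemma IsHalfLoose.exists_isLeftLoose {β : ℝ} (hβ : 1 < β) {P : Set Plane} (hfin : P.Finite)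
    (hsq : P ⊆ unitSquare) {u v : Plane} (h : IsHalfLoose β P u v) :
    ∃ u' v', IsLeftLoose β P u' v' ∧ dist u' v' ≤ dist u v := by
  have hSfin : {e : Plane × Plane | IsHalfLoose β P e.1 e.2}.Finite :=
    (hfin.prod hfin).subset fun e he => ⟨he.1, he.2.1⟩
  obtain ⟨⟨a, b⟩, hab, hmin⟩ :=
    exists_min_image _ (fun e : Plane × Plane => dist e.1 e.2) hSfin ⟨(u, v), h⟩
  refine ⟨a, b, ?_, hmin (u, v) h⟩
  by_contra hl
  obtain ⟨y, hy, hlt⟩ := IsHalfLoose.exists_shorter hβ hfin hsq hab hl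
  exact absurd (hmin (a, y) hy) (not_le.2 hlt)

/-! ### Empty circles and Delaunay triangles -/

/-- `o` is the center of a circle through `p` and `q` with no vertex of `P` inside. -/
def IsEmptyCenter (P : Set Plane) (o p q : Plane) : Prop :=
  dist o p = dist o q ∧ ∀ x ∈ P, dist o p ≤ dist o x

lemma IsEmptyCenter.symm {P : Set Plane} {o p q : Plane} (h : IsEmptyCenter P o p q) :
    IsEmptyCenter P o q p :=
  ⟨h.1.symm, fun x hx => h.1 ▸ h.2 x hx⟩

lemma isEmptyCenter_chordCenter_iff {P : Set Plane} {t : ℝ} {u v : Plane} :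
    IsEmptyCenter P (chordCenter t u v) u v ↔ ∀ x ∈ P, 0 ≤ chordPower t u v x := by
  have h1 : dist (chordCenter t u v) u = dist (chordCenter t u v) v := by
    rw [← sq_eq_sq₀ dist_nonneg dist_nonneg, dist_chordCenter_left_sq, dist_chordCenter_right_sq]
  simp only [IsEmptyCenter, h1, true_and]
  refine forall₂_congr fun x _ => ?_
  rw [← sq_le_sq₀ dist_nonneg dist_nonneg, dist_chordCenter_right_sq, dist_chordCenter_sq]
  constructor <;> intro h <;> linarith

lemma ne_of_orient_ne_zero {u v w : Plane} (h : orient u v w ≠ 0) : u ≠ v ∧ u ≠ w ∧ v ≠ w := by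
  refine ⟨?_, ?_, ?_⟩ <;> rintro rfl <;> apply h <;> simp only [orient] <;> ring

/-- If the shortest edge of a Delaunay triangle is not half-loose, then its circumradius is
at most `β` times the length of this edge. -/
lemma circumradius_le_of_shortest {β : ℝ} (hβ : 1 < β) {P : Set Plane} (hsq : P ⊆ unitSquare)
    {u v w o : Plane} (hu : u ∈ P) (hv : v ∈ P) (hw : w ∈ P) (ho : 0 < orient u v w)
    (huv : IsEmptyCenter P o u v) (how : dist o u = dist o w) (hl : ¬ IsHalfLoose β P u v)
    (h1 : dist u v ≤ dist u w) : dist o u ≤ β * dist u v := by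
  obtain ⟨hne, -, -⟩ := ne_of_orient_ne_zero ho.ne'
  obtain ⟨t, rfl⟩ := exists_chordCenter_eq hne huv.1
  have hemp := isEmptyCenter_chordCenter_iff.1 huv
  have hl' : ¬ ∀ x ∈ P, 0 < orient u v x → 0 < chordPower (leafHeight β) u v x :=
    fun h => hl ⟨hu, hv, hne, ⟨w, hsq hw, ho⟩, h⟩
  push Not at hl'
  obtain ⟨x, hx, hxo, hxl⟩ := hl'
  -- The leaf contains a vertex to the left of the chord. Circles through the chord grow on that
  -- side with their height, so an empty one is no higher than the leaf.
  have htτ : t ≤ leafHeight β := by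
    have h2 := hemp x hx
    simp only [chordPower] at h2 hxl
    by_contra! hc
    have := mul_pos (sub_pos.2 hc) hxo
    linarith
  -- Since `u v` is no longer than `u w`, the angle at `w` is not obtuse, and the circumcenter is
  -- not to the right of `u v`.
  have ht0 : 0 ≤ t := by
    have hw0 : chordPower t u v w = 0 := by
      have e1 := dist_chordCenter_sq t u v w
      rw [← how, dist_chordCenter_left_sq] at e1
      linarith
    have hd : 0 ≤ dot u w v w := by
      have h3 : dist u v ^ 2 ≤ dist u w ^ 2 := by gcongr
      rw [dist_sq_eq, dist_sq_eq] at h3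
      simp only [dot]
      nlinarith [sq_nonneg (w 0 - v 0), sq_nonneg (w 1 - v 1)]
    rw [chordPower] at hw0
    by_contra! hc
    have := mul_neg_of_neg_of_pos hc ho
    linarith
  rw [← sq_le_sq₀ dist_nonneg (by positivity), dist_chordCenter_left_sq, mul_pow,
    ← leafHeight_sq hβ]
  gcongr

/-- If no pair of length at most `L` is half-loose, and a Delaunay triangle has an edge of length
at most `L`, then its circumradius is at most `β` times the length of each of its edges. -/
lemma circumradius_le {β : ℝ} (hβ : 1 < β) {P : Set Plane} (hsq : P ⊆ unitSquare) {L : ℝ}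
    (hL : ∀ u v, IsHalfLoose β P u v → L < dist u v)
    {u v w o : Plane} (hu : u ∈ P) (hv : v ∈ P) (hw : w ∈ P) (ho : 0 < orient u v w)
    (huv : IsEmptyCenter P o u v) (how : dist o u = dist o w) (huvL : dist u v ≤ L) :
    dist o u ≤ β * dist u v ∧ dist o u ≤ β * dist v w := by
  have hβ0 : 0 < β := by linarith
  have hvw : IsEmptyCenter P o v w := ⟨huv.1.symm.trans how, huv.symm.2⟩
  have hwu : IsEmptyCenter P o w u := ⟨how.symm, hvw.symm.2⟩
  have ho2 : 0 < orient v w u := by rwa [orient_rotate]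
  have ho3 : 0 < orient w u v := by rwa [orient_rotate, orient_rotate]
  have key : ∀ {a b : Plane}, dist a b ≤ dist u v → ¬ IsHalfLoose β P a b :=
    fun h h' => absurd (hL _ _ h') (not_lt.2 (h.trans huvL))
  have e1 := dist_comm w u
  have e2 := dist_comm v u
  rcases le_total (dist u v) (dist v w) with h1 | h1
  · rcases le_total (dist u v) (dist w u) with h2 | h2
    · have := circumradius_le_of_shortest hβ hsq hu hv hw ho huv how (key le_rfl) (e1 ▸ h2)
      exact ⟨this, this.trans (by gcongr)⟩
    · have := circumradius_le_of_shortest hβ hsq hw hu hv ho3 hwu hvw.1.symm (key h2)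
        (by rw [dist_comm w v]; linarith)
      rw [← how] at this
      exact ⟨this.trans (by gcongr), this.trans (mul_le_mul_of_nonneg_left (h2.trans h1) hβ0.le)⟩
  · rcases le_total (dist v w) (dist w u) with h2 | h2
    · have := circumradius_le_of_shortest hβ hsq hv hw hu ho2 hvw huv.1.symm (key h1)
        (by linarith)
      rw [← huv.1] at this
      exact ⟨this.trans (by gcongr), this⟩
    · have := circumradius_le_of_shortest hβ hsq hw hu hv ho3 hwu hvw.1.symm (key (h2.trans h1))
        (by rw [dist_comm w v]; linarith)
      rw [← how] at this
      exact ⟨this.trans (mul_le_mul_of_nonneg_left (h2.trans h1) hβ0.le), this.trans (by gcongr)⟩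

/-- A Delaunay edge with a vertex on its left side has a Delaunay triangle there. -/
lemma IsEmptyCenter.exists_triangle {P : Set Plane} (hfin : P.Finite) {o p a x : Plane}
    (h : IsEmptyCenter P o p a) (hx : x ∈ P) (hxo : 0 < orient p a x) :
    ∃ b ∈ P, 0 < orient p a b ∧ ∃ o', IsEmptyCenter P o' p a ∧ dist o' p = dist o' b := by
  obtain ⟨hne, -, -⟩ := ne_of_orient_ne_zero hxo.ne'
  obtain ⟨t, rfl⟩ := exists_chordCenter_eq hne h.1
  have hemp := isEmptyCenter_chordCenter_iff.1 h
  -- The circle through `p`, `a`, `x` has relative height `dot p x a x / (2 * orient p a x)`. The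
  -- lowest such circle is empty: to the left by minimality, to the right because raising the center
  -- only loses points there.
  obtain ⟨b, ⟨hb, hbo⟩, hmin⟩ := exists_min_image {x | x ∈ P ∧ 0 < orient p a x}
    (fun x => dot p x a x / (2 * orient p a x)) (hfin.subset fun x hx => hx.1) ⟨x, hx, hxo⟩
  set t' := dot p b a b / (2 * orient p a b) with ht'
  have htt' : t ≤ t' := by
    have := hemp b hb
    rw [ht', le_div_iff₀ (by positivity)]
    rw [chordPower] at this; linarith
  refine ⟨b, hb, hbo, chordCenter t' p a, isEmptyCenter_chordCenter_iff.2 fun y hy => ?_, ?_⟩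
  · rcases lt_or_ge 0 (orient p a y) with hyo | hyo
    · have := hmin y ⟨hy, hyo⟩
      change t' ≤ _ at this
      rw [le_div_iff₀ (by positivity)] at this
      rw [chordPower]; linarith
    · have h1 := hemp y hy
      rw [chordPower] at h1 ⊢
      have := mul_nonneg (sub_nonneg.2 htt') (neg_nonneg.2 hyo)
      linarith
  · have h0 : chordPower t' p a b = 0 := by
      rw [chordPower, ht']; field_simp; ring
    rw [← sq_eq_sq₀ dist_nonneg dist_nonneg, dist_chordCenter_left_sq, dist_chordCenter_sq, h0,
      add_zero]

/-! ### Angles in Delaunay triangles -/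

/-- The law of sines. -/
lemma dist_mul_dist_mul_dist_eq {o p a b : Plane} (ha : dist o p = dist o a)
    (hb : dist o p = dist o b) (ho : 0 ≤ orient p a b) :
    dist p a * dist p b * dist a b = 2 * dist o p * orient p a b := by
  have ha2 : dist o p ^ 2 = dist o a ^ 2 := by rw [ha]
  have hb2 : dist o p ^ 2 = dist o b ^ 2 := by rw [hb]
  rw [← sq_eq_sq₀ (by positivity) (by positivity)]
  simp only [mul_pow, dist_sq_eq, orient] at *
  obtain ⟨x, hx⟩ : ∃ x, x = a 0 - p 0 := ⟨_, rfl⟩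
  obtain ⟨y, hy⟩ : ∃ x, x = a 1 - p 1 := ⟨_, rfl⟩
  obtain ⟨z, hz⟩ : ∃ x, x = b 0 - p 0 := ⟨_, rfl⟩
  obtain ⟨w, hw⟩ : ∃ x, x = b 1 - p 1 := ⟨_, rfl⟩
  obtain ⟨c, hc⟩ : ∃ x, x = o 0 - p 0 := ⟨_, rfl⟩
  obtain ⟨d, hd⟩ : ∃ x, x = o 1 - p 1 := ⟨_, rfl⟩
  have e1 : x ^ 2 + y ^ 2 = 2 * (c * x + d * y) := by rw [hx, hy, hc, hd]; linarith
  have e2 : z ^ 2 + w ^ 2 = 2 * (c * z + d * w) := by rw [hz, hw, hc, hd]; linarith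
  -- Cramer's rule for the circumcenter `(c, d)` relative to `p`.
  have f1 : 2 * c * (x * w - y * z) = (x ^ 2 + y ^ 2) * w - (z ^ 2 + w ^ 2) * y := by
    linear_combination (-w) * e1 + y * e2
  have f2 : 2 * d * (x * w - y * z) = (z ^ 2 + w ^ 2) * x - (x ^ 2 + y ^ 2) * z := by
    linear_combination z * e1 - x * e2
  have : (x ^ 2 + y ^ 2) * (z ^ 2 + w ^ 2) * ((x - z) ^ 2 + (y - w) ^ 2) =
      (2 * c * (x * w - y * z)) ^ 2 + (2 * d * (x * w - y * z)) ^ 2 := by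
    rw [f1, f2]; ring
  subst hx hy hz hw hc hd
  linear_combination this

/-- The vector from `p` to `x` as a complex number. -/
def toC (p x : Plane) : ℂ := ⟨x 0 - p 0, x 1 - p 1⟩

lemma norm_toC (p x : Plane) : ‖toC p x‖ = dist p x := by
  rw [← sq_eq_sq₀ (norm_nonneg _) dist_nonneg, ← Complex.normSq_eq_norm_sq, dist_sq_eq,
    Complex.normSq_apply, toC]
  ring

lemma toC_ne_zero {p x : Plane} (h : p ≠ x) : toC p x ≠ 0 := by
  rw [← norm_pos_iff, norm_toC]; exact dist_pos.2 h

lemma div_toC_im (p a b : Plane) : (toC p b / toC p a).im = orient p a b / dist p a ^ 2 := by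
  rw [Complex.div_im, Complex.normSq_eq_norm_sq, norm_toC, toC, toC, orient]; ring

lemma div_toC_re (p a b : Plane) : (toC p b / toC p a).re = dot p a p b / dist p a ^ 2 := by
  rw [Complex.div_re, Complex.normSq_eq_norm_sq, norm_toC, toC, toC, dot]; ring

/-- The angle by which `p a` has to be turned in order to point towards `b`. -/
def turn (p a b : Plane) : ℝ := Complex.arg (toC p b / toC p a)

lemma turn_nonneg_iff {p a b : Plane} (h : p ≠ a) : 0 ≤ turn p a b ↔ 0 ≤ orient p a b := by
  have := dist_pos.2 h
  rw [turn, Complex.arg_nonneg_iff, div_toC_im, le_div_iff₀ (by positivity), zero_mul]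

lemma sin_turn {p a b : Plane} (ha : p ≠ a) (hb : p ≠ b) :
    Real.sin (turn p a b) = orient p a b / (dist p a * dist p b) := by
  have h1 := dist_pos.2 ha
  have h2 := dist_pos.2 hb
  rw [turn, Complex.sin_arg, div_toC_im, norm_div, norm_toC, norm_toC]
  field_simp

lemma turn_pos_of_orient_pos {p a b : Plane} (h : 0 < orient p a b) : 0 < turn p a b := by
  obtain ⟨h1, h2, -⟩ := ne_of_orient_ne_zero h.ne'
  refine ((turn_nonneg_iff h1).2 h.le).lt_of_ne fun h0 => ?_
  have h3 := sin_turn h1 h2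
  have := dist_pos.2 h1
  have := dist_pos.2 h2
  rw [← h0, Real.sin_zero] at h3
  have : 0 < orient p a b / (dist p a * dist p b) := by positivity
  linarith

lemma orient_pos_of_turn_pos {p a b : Plane} (ha : p ≠ a) (h : 0 < turn p a b) :
    0 < orient p a b ∨ orient p a b = 0 ∧ dot p a p b < 0 := by
  have h1 := (turn_nonneg_iff ha).1 h.le
  rcases h1.lt_or_eq with h2 | h2
  · exact Or.inl h2
  · refine Or.inr ⟨h2.symm, ?_⟩
    by_contra! hc
    have : turn p a b = 0 := by
      rw [turn, Complex.arg_eq_zero_iff]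
      constructor
      · rw [div_toC_re]; positivity
      · rw [div_toC_im, ← h2, zero_div]
    linarith

/-- Arguments add as long as the sum is at most `π`. A larger sum would lie strictly below `2π`, as
`turn p a b` is not `π`, and its sine would be negative, contrary to `0 ≤ orient p a q`. -/
lemma turn_add_turn {p a b q : Plane} (ha : p ≠ a) (hb : p ≠ b) (hq : p ≠ q)
    (h1 : 0 < orient p a b) (h2 : 0 < orient p b q) (h3 : 0 ≤ orient p a q) :
    turn p a q = turn p a b + turn p b q := by
  have hmul : toC p q / toC p a = toC p b / toC p a * (toC p q / toC p b) := by
    have := toC_ne_zero ha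
    have := toC_ne_zero hb
    field_simp
  have hx : toC p b / toC p a ≠ 0 := div_ne_zero (toC_ne_zero hb) (toC_ne_zero ha)
  have hy : toC p q / toC p b ≠ 0 := div_ne_zero (toC_ne_zero hq) (toC_ne_zero hb)
  have p1 := turn_pos_of_orient_pos h1
  have p2 := turn_pos_of_orient_pos h2
  have l1 : turn p a b ≤ Real.pi := Complex.arg_le_pi _
  have l2 : turn p b q ≤ Real.pi := Complex.arg_le_pi _
  have hs : Real.sin (turn p a b + turn p b q) = Real.sin (turn p a q) := by
    have := Complex.arg_mul_coe_angle hx hy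
    rw [← hmul, ← Real.Angle.coe_add] at this
    rw [← Real.Angle.sin_coe, ← Real.Angle.sin_coe]
    exact congrArg Real.Angle.sin this.symm
  have hle : turn p a b + turn p b q ≤ Real.pi := by
    by_contra! hc
    have hlt : turn p a b + turn p b q < 2 * Real.pi := by
      refine lt_of_le_of_ne (by linarith) fun he => ?_
      have e : turn p a b = Real.pi := by linarith
      have := sin_turn ha hb
      rw [e, Real.sin_pi] at this
      have := dist_pos.2 ha
      have := dist_pos.2 hb
      have : 0 < orient p a b / (dist p a * dist p b) := by positivity
      linarith
    have hneg : Real.sin (turn p a b + turn p b q) < 0 := by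
      rw [← Real.sin_sub_two_pi]
      exact Real.sin_neg_of_neg_of_neg_pi_lt (by linarith) (by linarith)
    have : 0 ≤ Real.sin (turn p a q) := by rw [sin_turn ha hq]; positivity
    linarith
  rw [turn, hmul, Complex.arg_mul hx hy ⟨?_, hle⟩]
  · rfl
  · change -Real.pi < turn p a b + turn p b q
    linarith [Real.pi_pos]

lemma smallAngle_pos {β : ℝ} (hβ : 1 < β) : 0 < smallAngle β :=
  Real.arcsin_pos.2 (by positivity)

/-- A Delaunay triangle with a circumradius at most `β` times as large as its edges has no small
angle. -/
lemma smallAngle_le_turn {β : ℝ} (hβ : 1 < β) {o p a b : Plane} (ha : dist o p = dist o a)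
    (hb : dist o p = dist o b) (ho : 0 < orient p a b) (h : dist o p ≤ β * dist a b) :
    smallAngle β ≤ turn p a b := by
  obtain ⟨h1, h2, h3⟩ := ne_of_orient_ne_zero ho.ne'
  rcases le_total (Real.pi / 2) (turn p a b) with hle | hle
  · exact (Real.arcsin_le_pi_div_two _).trans hle
  have hpos := turn_pos_of_orient_pos ho
  have hβ1 : 1 / (2 * β) ≤ 1 := by rw [div_le_one (by positivity)]; linarith
  have hβ0 : 0 < 1 / (2 * β) := by positivity
  rw [smallAngle, Real.arcsin_le_iff_le_sin ⟨by linarith, hβ1⟩ ⟨by linarith, hle⟩, sin_turn h1 h2]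
  have hlaw := dist_mul_dist_mul_dist_eq ha hb ho.le
  have h1' := dist_pos.2 h1
  have h2' := dist_pos.2 h2
  have h3' := dist_pos.2 h3
  rw [div_le_div_iff₀ (by positivity) (by positivity), one_mul]
  refine le_of_mul_le_mul_right ?_ h3'
  rw [hlaw]
  have := mul_le_mul_of_nonneg_right h ho.le
  linarith

/-- Let `p a b` be a Delaunay triangle and `q` a Delaunay neighbor of `p` whose direction is
between those of `a` and `b`. Then `q` lies on the circumcircle. -/
lemma dist_eq_of_between {P : Set Plane} {o o' p a b q : Plane} (haP : a ∈ P) (hbP : b ∈ P)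
    (hqP : q ∈ P) (hq : IsEmptyCenter P o p q) (ha : IsEmptyCenter P o' p a)
    (hb : dist o' p = dist o' b) (hab : 0 < orient p a b) (haq : 0 ≤ orient p a q)
    (hqb : orient p b q ≤ 0) : dist o' p = dist o' q := by
  refine le_antisymm (ha.2 q hqP) ?_
  have s1 : dist o p ^ 2 = dist o q ^ 2 := by rw [hq.1]
  have s2 : dist o p ^ 2 ≤ dist o a ^ 2 := by have := hq.2 a haP; gcongr
  have s3 : dist o p ^ 2 ≤ dist o b ^ 2 := by have := hq.2 b hbP; gcongr
  have s4 : dist o' p ^ 2 = dist o' a ^ 2 := by rw [ha.1]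
  have s5 : dist o' p ^ 2 = dist o' b ^ 2 := by rw [hb]
  rw [← sq_le_sq₀ dist_nonneg dist_nonneg]
  -- The difference of the powers with respect to two circles through `p` is linear in the vector
  -- from `p`, and `q` is a nonnegative combination of `a` and `b` as seen from `p`.
  have key : orient p a b * ((dist o q ^ 2 - dist o p ^ 2) - (dist o' q ^ 2 - dist o' p ^ 2)) =
      -orient p b q * ((dist o a ^ 2 - dist o p ^ 2) - (dist o' a ^ 2 - dist o' p ^ 2)) +
      orient p a q * ((dist o b ^ 2 - dist o p ^ 2) - (dist o' b ^ 2 - dist o' p ^ 2)) := by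
    simp only [dist_sq_eq, orient]; ring
  have t1 : 0 ≤ -orient p b q *
      ((dist o a ^ 2 - dist o p ^ 2) - (dist o' a ^ 2 - dist o' p ^ 2)) :=
    mul_nonneg (by linarith) (by linarith)
  have t2 : 0 ≤ orient p a q *
      ((dist o b ^ 2 - dist o p ^ 2) - (dist o' b ^ 2 - dist o' p ^ 2)) :=
    mul_nonneg haq (by linarith)
  by_contra! hc
  have := mul_neg_of_pos_of_neg hab (by linarith :
    (dist o q ^ 2 - dist o p ^ 2) - (dist o' q ^ 2 - dist o' p ^ 2) < 0)
  linarith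

/-! ### Rotating around a vertex -/

/-- An edge without vertices to its left is vacuously half-loose if it faces the domain. This keeps
the rotation from stopping at a hull edge. -/
lemma exists_left_of_not_isHalfLoose {β : ℝ} {P : Set Plane} {u v : Plane} (hu : u ∈ P)
    (hv : v ∈ P) (hne : u ≠ v) (hface : FacesDomain u v) (h : ¬ IsHalfLoose β P u v) :
    ∃ x ∈ P, 0 < orient u v x := by
  by_contra! hc
  exact h ⟨hu, hv, hne, hface, fun x hx hxo => absurd hxo (not_lt.2 (hc x hx))⟩

/-- Turning around `p`, the lengths of the Delaunay edges grow at most exponentially in the angle,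
unless there is a short half-loose pair. -/
lemma dist_le_rpow_turn_mul {β : ℝ} (hβ : 1 < β) {P : Set Plane} (hfin : P.Finite)
    (hsq : P ⊆ unitSquare) {L : ℝ} (hL : ∀ u v, IsHalfLoose β P u v → L < dist u v)
    {o p q : Plane} (hp : p ∈ P) (hqP : q ∈ P) (hpq : p ≠ q) (hq : IsEmptyCenter P o p q)
    (n : ℕ) {a o₁ : Plane} (ha : a ∈ P) (hpa : p ≠ a) (hae : IsEmptyCenter P o₁ p a)
    (hface : FacesDomain p a) (hturn : 0 < turn p a q) (hn : turn p a q ≤ n * smallAngle β)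
    (hlen : (2 * β) ^ (turn p a q / smallAngle β) * dist p a ≤ L) :
    dist p q ≤ (2 * β) ^ (turn p a q / smallAngle β) * dist p a := by
  have hα := smallAngle_pos hβ
  induction n generalizing a o₁ with
  | zero => simp at hn; linarith
  | succ n ih =>
    have h2β : 1 ≤ 2 * β := by linarith
    have haL : dist p a ≤ L :=
      le_trans (le_mul_of_one_le_left dist_nonneg (Real.one_le_rpow h2β (by positivity))) hlen
    have hnot : ¬ IsHalfLoose β P p a := fun h => absurd (hL _ _ h) (not_lt.2 haL)
    obtain ⟨x, hx, hxo⟩ := exists_left_of_not_isHalfLoose hp ha hpa hface hnot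
    obtain ⟨b, hb, hab, o', ha', hb'⟩ := hae.exists_triangle hfin hx hxo
    obtain ⟨-, hpb, hne⟩ := ne_of_orient_ne_zero hab.ne'
    have haq : 0 ≤ orient p a q := (turn_nonneg_iff hpa).1 hturn.le
    obtain ⟨hρ, hρ'⟩ := circumradius_le hβ hsq hL hp ha hb hab ha' hb' haL
    have hdiam : ∀ x, dist o' p = dist o' x → dist p x ≤ 2 * β * dist p a := fun x hx => by
      have := dist_triangle_left p x o'
      linarith
    rcases lt_or_ge 0 (orient p b q) with hbq | hbq
    · have hadd := turn_add_turn hpa hpb hpq hab hbq haq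
      have hα' := smallAngle_le_turn hβ ha'.1 hb' hab hρ'
      -- The factor `2β` gained in length is paid for by the angle, at least `α`, that has been used
      -- up; the same angle lowers the bound `n`.
      have hle : (2 * β) ^ (turn p b q / smallAngle β) * dist p b ≤
          (2 * β) ^ (turn p a q / smallAngle β) * dist p a := by
        calc (2 * β) ^ (turn p b q / smallAngle β) * dist p b
            ≤ (2 * β) ^ (turn p b q / smallAngle β) * (2 * β * dist p a) :=
              mul_le_mul_of_nonneg_left (hdiam b hb') (by positivity)
          _ = (2 * β) ^ (turn p b q / smallAngle β + 1) * dist p a := by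
              rw [Real.rpow_add (by positivity), Real.rpow_one]; ring
          _ ≤ _ := by
              refine mul_le_mul_of_nonneg_right (Real.rpow_le_rpow_of_exponent_le h2β ?_)
                dist_nonneg
              rw [div_add_one hα.ne', div_le_div_iff_of_pos_right hα]
              linarith
      refine (ih hb hpb ⟨hb', ha'.2⟩ ⟨q, hsq hqP, hbq⟩ (turn_pos_of_orient_pos hbq) ?_
        (hle.trans hlen)).trans hle
      push_cast at hn
      linarith
    -- Here `q` is reached within the triangle `p a b`. It is cocircular with it, but need not be
    -- `b`, so the estimates are repeated for the triangle `p a q`.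
    · have hq' := dist_eq_of_between ha hb hqP hq ha' hb' hab haq hbq
      have haq' : 0 < orient p a q := by
        rcases orient_pos_of_turn_pos hpa hturn with h | ⟨h0, hd⟩
        · exact h
        · have key : orient p a b * dot p a p q =
              -orient p b q * dot p a p a + orient p a q * dot p a p b := by
            simp only [dot, orient]; ring
          have := mul_neg_of_pos_of_neg hab hd
          have := mul_nonneg (neg_nonneg.2 hbq) (dot_self_pos hpa).le
          rw [h0] at key
          linarith
      obtain ⟨-, hρq⟩ := circumradius_le hβ hsq hL hp ha hqP haq' ha' hq' haL
      have hα' := smallAngle_le_turn hβ ha'.1 hq' haq' hρq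
      refine (hdiam q hq').trans (mul_le_mul_of_nonneg_right ?_ dist_nonneg)
      calc 2 * β = (2 * β) ^ (1 : ℝ) := (Real.rpow_one _).symm
        _ ≤ _ := Real.rpow_le_rpow_of_exponent_le h2β ((one_le_div hα).2 hα')

lemma one_le_cGbu {β : ℝ} (hβ : 1 < β) : 1 ≤ cGbu β :=
  Real.one_le_rpow (by linarith) (div_nonneg Real.pi_pos.le (smallAngle_pos hβ).le)

/-- The rotation starts at a Delaunay edge: every other point of the open diametral disk of `p a` is
closer to `p` than `a`. -/
lemma isEmptyCenter_of_nearest {P : Set Plane} {p a : Plane}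
    (h : ∀ x ∈ P, x ≠ p → dist p a ≤ dist p x) : IsEmptyCenter P (chordCenter 0 p a) p a := by
  rw [isEmptyCenter_chordCenter_iff]
  intro x hx
  by_cases hxp : x = p
  · subst hxp; simp [chordPower, dot, orient]
  have h2 : dist p a ^ 2 ≤ dist p x ^ 2 := by have := h x hx hxp; gcongr
  rw [dist_sq_eq, dist_sq_eq] at h2
  simp only [chordPower, dot]
  nlinarith [sq_nonneg (x 0 - a 0), sq_nonneg (x 1 - a 1)]

/-- The Delaunay edges at `p` are bounded in terms of the distance of `p` to its nearest vertex `a`,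
unless there is a short loose pair; the case of a Delaunay neighbor to the left of `p a`. -/
lemma dist_le_cGbu_mul_of_turn_pos {β : ℝ} (hβ : 1 < β) {P : Set Plane} (hfin : P.Finite)
    (hsq : P ⊆ unitSquare) {a o p q : Plane}
    (hL : ∀ u v, IsLeftLoose β P u v → cGbu β * dist p a < dist u v)
    (hp : p ∈ P) (ha : a ∈ P) (hpa : p ≠ a)
    (hnear : ∀ x ∈ P, x ≠ p → dist p a ≤ dist p x) (hqP : q ∈ P) (hpq : p ≠ q)
    (hq : IsEmptyCenter P o p q) (hface : FacesDomain p a) (hturn : 0 < turn p a q) :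
    dist p q ≤ cGbu β * dist p a := by
  have hL' : ∀ u v, IsHalfLoose β P u v → cGbu β * dist p a < dist u v := fun u v h => by
    obtain ⟨u', v', h1, h2⟩ := h.exists_isLeftLoose hβ hfin hsq
    exact (hL u' v' h1).trans_le h2
  have hα := smallAngle_pos hβ
  have hle : (2 * β) ^ (turn p a q / smallAngle β) * dist p a ≤ cGbu β * dist p a := by
    refine mul_le_mul_of_nonneg_right (Real.rpow_le_rpow_of_exponent_le (by linarith) ?_)
      dist_nonneg
    -- A turn is at most `π`, whence the exponent in `cGbu`.
    rw [div_le_div_iff_of_pos_right hα]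
    exact Complex.arg_le_pi _
  obtain ⟨n, hn⟩ := exists_nat_ge (turn p a q / smallAngle β)
  exact (dist_le_rpow_turn_mul hβ hfin hsq hL' hp hqP hpq hq n ha hpa
    (isEmptyCenter_of_nearest hnear) hface hturn ((div_le_iff₀ hα).1 hn) hle).trans hle

/-! ### Reflection, and the bound for neighbors on either side -/

/-- Reflection in the diagonal of the unit square. -/
def reflect (x : Plane) : Plane := !₂[x 1, x 0]

@[simp] lemma reflect_zero (x : Plane) : reflect x 0 = x 1 := rfl
@[simp] lemma reflect_one (x : Plane) : reflect x 1 = x 0 := rfl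
@[simp] lemma reflect_reflect (x : Plane) : reflect (reflect x) = x := plane_ext rfl rfl

lemma reflect_injective : Function.Injective reflect :=
  Function.LeftInverse.injective reflect_reflect

@[simp] lemma dist_reflect (x y : Plane) : dist (reflect x) (reflect y) = dist x y := by
  rw [← sq_eq_sq₀ dist_nonneg dist_nonneg, dist_sq_eq, dist_sq_eq]; simp; ring

lemma orient_reflect (u v x : Plane) :
    orient (reflect u) (reflect v) (reflect x) = orient v u x := by
  simp [orient]; ring

lemma chordPower_reflect (t : ℝ) (u v x : Plane) :
    chordPower t (reflect u) (reflect v) (reflect x) = chordPower t v u x := by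
  simp [chordPower, orient, dot]; ring

lemma reflect_mem_unitSquare {x : Plane} (hx : x ∈ unitSquare) : reflect x ∈ unitSquare := by
  intro i; fin_cases i
  · exact hx 1
  · exact hx 0

lemma IsLeftLoose.of_reflect {β : ℝ} (hβ : 1 < β) {P : Set Plane} {u v : Plane}
    (h : IsLeftLoose β (reflect ⁻¹' P) u v) : IsLeftLoose β P (reflect v) (reflect u) := by
  obtain ⟨hu, hv, hne, ⟨w, hw, hwo⟩, hemp⟩ := h
  refine ⟨hv, hu, fun h => hne (reflect_injective h).symm,
    ⟨reflect w, reflect_mem_unitSquare hw, by rwa [orient_reflect]⟩, fun x hx hxl => ?_⟩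
  rw [mem_leftLeaf hβ, ← reflect_reflect x, chordPower_reflect, ← mem_leftLeaf hβ] at hxl
  rcases hemp (reflect x) (by simpa using hx) hxl with h | h
  · right; rw [← h, reflect_reflect]
  · left; rw [← h, reflect_reflect]

/-- Otherwise the affine function `orient p a` vanishes on the whole square, in particular at three
corners. -/
lemma facesDomain_or_facesDomain {p a : Plane} (hpa : p ≠ a) :
    FacesDomain p a ∨ FacesDomain a p := by
  by_contra! hc
  simp only [FacesDomain, not_exists, not_and, not_lt] at hc
  obtain ⟨h1, h2⟩ := hc
  have key : ∀ x ∈ unitSquare, orient p a x = 0 := fun x hx =>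
    le_antisymm (h1 x hx) (by have := h2 x hx; rw [orient_swap] at this; linarith)
  have m : ∀ r s : ℝ, 0 ≤ r → r ≤ 1 → 0 ≤ s → s ≤ 1 → (!₂[r, s] : Plane) ∈ unitSquare := by
    intro r s h1 h2 h3 h4 i
    fin_cases i
    · exact ⟨h1, h2⟩
    · exact ⟨h3, h4⟩
  have k0 := key _ (m 0 0 le_rfl zero_le_one le_rfl zero_le_one)
  have k1 := key _ (m 1 0 zero_le_one le_rfl le_rfl zero_le_one)
  have k2 := key _ (m 0 1 le_rfl zero_le_one zero_le_one le_rfl)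
  simp [orient] at k0 k1 k2
  exact hpa (plane_ext (by linarith) (by linarith))

/-- A disk with `p` and `q` on its boundary contains the open segment between them. -/
lemma dist_le_of_collinear {o p a q : Plane} (hpa : p ≠ a) (hpq : p ≠ q)
    (ho : orient p a q = 0) (hdot : 0 ≤ dot p a p q) (h1 : dist o p ^ 2 = dist o q ^ 2)
    (h2 : dist o p ^ 2 ≤ dist o a ^ 2) : dist p q ≤ dist p a := by
  have hA := dot_self_pos hpa
  have hQ := dot_self_pos hpq
  have e1 : dot p q p q = 2 * dot p o p q := by
    simp only [dist_sq_eq] at h1; simp only [dot]; linarith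
  have e2 : 2 * dot p o p a ≤ dot p a p a := by
    simp only [dist_sq_eq] at h2; simp only [dot]; linarith
  have e3 : dot p q p q * dot p o p a = dot p a p q * dot p o p q := by
    have : dot p q p q * dot p o p a = dot p a p q * dot p o p q + orient p a q *
        ((o 0 - p 0) * (q 1 - p 1) - (o 1 - p 1) * (q 0 - p 0)) := by
      simp only [dot, orient]; ring
    rw [this, ho]; ring
  have e4 : dot p q p q * dot p a p a = dot p a p q ^ 2 := by
    have : dot p q p q * dot p a p a = dot p a p q ^ 2 + orient p a q ^ 2 := by
      simp only [dot, orient]; ring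
    rw [this, ho]; ring
  have e5 : 2 * dot p o p a = dot p a p q := by
    refine mul_left_cancel₀ hQ.ne' ?_
    linear_combination 2 * e3 - dot p a p q * e1
  have e6 : dot p q p q ≤ dot p a p a := by
    refine le_of_mul_le_mul_right ?_ hA
    rw [e4, ← sq]
    exact pow_le_pow_left₀ hdot (e5 ▸ e2) 2
  rw [← sq_le_sq₀ dist_nonneg dist_nonneg, dist_sq_eq, dist_sq_eq]
  simp only [dot] at e6
  linarith

/-- The Delaunay edges at `p` are bounded in terms of the distance of `p` to its nearest vertex `a`,
unless there is a short loose pair. -/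
lemma dist_le_cGbu_mul {β : ℝ} (hβ : 1 < β) {P : Set Plane} (hfin : P.Finite)
    (hsq : P ⊆ unitSquare) {a o p q : Plane}
    (hL : ∀ u v, IsLeftLoose β P u v → cGbu β * dist p a < dist u v)
    (hp : p ∈ P) (ha : a ∈ P) (hpa : p ≠ a)
    (hnear : ∀ x ∈ P, x ≠ p → dist p a ≤ dist p x) (hqP : q ∈ P) (hpq : p ≠ q)
    (hq : IsEmptyCenter P o p q) : dist p q ≤ cGbu β * dist p a := by
  have hrefl : FacesDomain a p → 0 < turn (reflect p) (reflect a) (reflect q) →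
      dist p q ≤ cGbu β * dist p a := by
    rintro ⟨w, hw, hwo⟩ hturn
    have himg : reflect ⁻¹' P = reflect '' P :=
      (congrFun (image_eq_preimage_of_inverse reflect_reflect reflect_reflect) P).symm
    have hfin' : (reflect ⁻¹' P).Finite := himg ▸ hfin.image _
    have hiff : ∀ x, reflect x ∈ reflect ⁻¹' P ↔ x ∈ P := fun x => by simp
    have := dist_le_cGbu_mul_of_turn_pos (P := reflect ⁻¹' P) (a := reflect a) (o := reflect o)
      (p := reflect p) (q := reflect q) hβ hfin'
      (fun x hx => by simpa using reflect_mem_unitSquare (hsq hx))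
      (fun u v h => by simpa [dist_comm] using hL _ _ (h.of_reflect hβ))
      ((hiff p).2 hp) ((hiff a).2 ha) (fun h => hpa (reflect_injective h))
      (fun x hx hxp => by
        have h1 : reflect x ≠ p := by rintro rfl; simp at hxp
        have := hnear _ hx h1
        rw [← dist_reflect p (reflect x)] at this
        simpa using this)
      ((hiff q).2 hqP) (fun h => hpq (reflect_injective h))
      ⟨by simpa using hq.1, fun x hx => by
        have := hq.2 _ hx
        rw [← dist_reflect o (reflect x)] at this
        simpa using this⟩
      ⟨reflect w, reflect_mem_unitSquare hw, by rwa [orient_reflect]⟩ hturn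
    simpa using this
  have hd := dot_self_pos hpa
  rcases lt_trichotomy (orient p a q) 0 with ho | ho | ho
  · refine hrefl ⟨q, hsq hqP, by rw [orient_swap]; linarith⟩ (turn_pos_of_orient_pos ?_)
    rw [orient_reflect, orient_swap]; linarith
  · rcases lt_or_ge (dot p a p q) 0 with hdot | hdot
    -- If `q` is opposite to `a`, the turn is `π` in either sense, and the rotation goes through a
    -- side that faces the domain.
    · have hpi : ∀ {p a q : Plane}, p ≠ a → orient p a q = 0 → dot p a p q < 0 →
          0 < turn p a q := by
        intro p a q hpa ho hdot
        have := dist_pos.2 hpa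
        rw [turn, Complex.arg_eq_pi_iff.2 ⟨?_, ?_⟩]
        · exact Real.pi_pos
        · rw [div_toC_re]; exact div_neg_of_neg_of_pos hdot (by positivity)
        · rw [div_toC_im, ho, zero_div]
      rcases facesDomain_or_facesDomain hpa with hf | hf
      · exact dist_le_cGbu_mul_of_turn_pos hβ hfin hsq hL hp ha hpa hnear hqP hpq hq hf
          (hpi hpa ho hdot)
      · refine hrefl hf (hpi (fun h => hpa (reflect_injective h)) ?_ ?_)
        · rw [orient_reflect, orient_swap, ho, neg_zero]
        · simp only [dot, reflect_zero, reflect_one] at hdot ⊢; linarith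
    · have hle := hnear q hqP (Ne.symm hpq)
      have h1 : dist o p ^ 2 = dist o q ^ 2 := by rw [hq.1]
      have h2 : dist o p ^ 2 ≤ dist o a ^ 2 := by have := hq.2 a ha; gcongr
      have hqle := dist_le_of_collinear hpa hpq ho hdot h1 h2
      exact hqle.trans (le_mul_of_one_le_left dist_nonneg (one_le_cGbu hβ))
  · exact dist_le_cGbu_mul_of_turn_pos hβ hfin hsq hL hp ha hpa hnear hqP hpq hq
      ⟨q, hsq hqP, ho⟩ (turn_pos_of_orient_pos ho)

/-! ### Consequences for loose pairs, moonstruck points and off-centers -/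

lemma IsLeftLoose.isEmptyCenter {β : ℝ} (hβ : 1 < β) {P : Set Plane} {u v : Plane}
    (h : IsLeftLoose β P u v) : IsEmptyCenter P (leafCenter β u v) u v := by
  have e1 := dist_leafCenter hβ u v
  have e2 := dist_leafCenter' hβ u v
  refine ⟨e1.trans e2.symm, fun x hx => ?_⟩
  by_contra! hc
  rcases h.2.2.2.2 x hx (by rw [leftLeaf, mem_closedBall']; linarith) with rfl | rfl <;> linarith

lemma IsLeftMoonstruckAt.isEmptyCenter {β : ℝ} {P : Set Plane} {u v w o : Plane}
    (h : IsLeftMoonstruckAt β P u v w o) : IsEmptyCenter P o u v :=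
  ⟨h.2.2.2.1.1, fun x hx => by simpa [dist_comm] using h.2.2.2.2 x hx⟩

/-- The disk around the apex is covered by the crescent and the leaf; the former has no vertex, the
latter only `u` and `v`. -/
lemma IsLeftOffCenter.isEmptyCenter {β : ℝ} {P : Set Plane} {u v r : Plane}
    (h : IsLeftOffCenter β P u v r) : IsEmptyCenter P r u v := by
  rcases h with ⟨hl, hcr, rfl⟩ | ⟨w, hw⟩
  · have e : dist (leafApex β u v) u = dist (leafApex β u v) v := by
      change dist (chordCenter (β + leafHeight β) u v) u =
        dist (chordCenter (β + leafHeight β) u v) v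
      rw [← sq_eq_sq₀ dist_nonneg dist_nonneg, dist_chordCenter_left_sq,
        dist_chordCenter_right_sq]
    refine ⟨e, fun x hx => ?_⟩
    by_contra! hc
    have hmem : x ∈ leftLeaf β u v := by
      by_contra hn
      exact hcr x hx ⟨by rw [mem_closedBall']; exact hc.le, hn⟩
    rcases hl.2.2.2.2 x hx hmem with rfl | rfl <;> linarith
  · exact hw.isEmptyCenter

lemma IsOffCenter.isEmptyCenter {β : ℝ} {P : Set Plane} {u v r : Plane}
    (h : IsOffCenter β P u v r) : IsEmptyCenter P r u v :=
  h.elim (·.isEmptyCenter) (·.isEmptyCenter.symm)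

/-- A vertex `p` at distance at most `d` from another one is neither an endpoint nor a moonstruck
point of a loose pair if all loose pairs are longer than `2 c_gbu d`. -/
lemma not_isLoosePair_and_not_isMoonstruck {β : ℝ} (hβ : 1 < β) {P : Set Plane} (hfin : P.Finite)
    (hsq : P ⊆ unitSquare) {p : Plane} (hp : p ∈ P) {d : ℝ} (hd : ∃ x ∈ P, x ≠ p ∧ dist p x ≤ d)
    (hL : ∀ u v, IsLeftLoose β P u v → 2 * cGbu β * d < dist u v) :
    (∀ q, ¬ IsLoosePair β P p q) ∧ (∀ q q', ¬ IsMoonstruck β P q q' p) := by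
  obtain ⟨x, hx, hxp, hxd⟩ := hd
  obtain ⟨a, ⟨ha, hap⟩, hmin⟩ := exists_min_image {x | x ∈ P ∧ x ≠ p} (fun x => dist p x)
    (hfin.subset fun x hx => hx.1) ⟨x, hx, hxp⟩
  have hg := one_le_cGbu hβ
  have hle : cGbu β * dist p a ≤ cGbu β * d :=
    mul_le_mul_of_nonneg_left ((hmin x ⟨hx, hxp⟩).trans hxd) (by linarith)
  have hgd : 0 ≤ cGbu β * d := le_trans (by positivity) hle
  have hL' : ∀ u v, IsLeftLoose β P u v → cGbu β * dist p a < dist u v := fun u v h => by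
    have := hL u v h
    linarith
  have key : ∀ {o q}, q ∈ P → p ≠ q → IsEmptyCenter P o p q → dist p q ≤ cGbu β * d :=
    fun hq hpq h => (dist_le_cGbu_mul hβ hfin hsq hL' hp ha (Ne.symm hap)
      (fun x hx hxp => hmin x ⟨hx, hxp⟩) hq hpq h).trans hle
  constructor
  · rintro q (h | h)
    · have h1 := hL p q h
      have h2 := key h.2.1 h.2.2.1 (h.isEmptyCenter hβ)
      linarith
    · have h1 := hL q p h
      have h2 := key h.1 h.2.2.1.symm (h.isEmptyCenter hβ).symm
      rw [dist_comm] at h1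
      linarith
  · have moon : ∀ q q' o, ¬ IsLeftMoonstruckAt β P q q' p o := by
      intro q q' o h
      have hl := h.1
      have e := h.isEmptyCenter
      have eo : dist o q = dist o p := h.2.2.2.1.2
      have hpl : p ∉ leftLeaf β q q' := h.2.2.1.2
      have h1 : p ≠ q := by
        rintro rfl
        exact hpl (by rw [leftLeaf, mem_closedBall', dist_leafCenter hβ])
      have h2 : p ≠ q' := by
        rintro rfl
        exact hpl (by rw [leftLeaf, mem_closedBall', dist_leafCenter' hβ])
      -- The empty circle through `q`, `q'`, `p` makes `p` a Delaunay neighbor of both. Adding the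
      -- two bounds is what costs the factor `2` in `hL`.
      have h3 := key (o := o) hl.1 h1 ⟨eo.symm, fun x hx => eo ▸ e.2 x hx⟩
      have h4 := key (o := o) hl.2.1 h2 ⟨eo.symm.trans e.1, fun x hx => eo ▸ e.2 x hx⟩
      have h5 := hL q q' hl
      have := dist_triangle_left q q' p
      linarith
    rintro q q' ⟨o, h | h⟩
    · exact moon _ _ _ h
    · exact moon _ _ _ h

/-! ### Quadtree cells -/

lemma Cell.size_pos (C : Cell) : 0 < C.size := by rw [Cell.size]; positivity

lemma Cell.size_le_iff {C D : Cell} : C.size ≤ D.size ↔ D.depth ≤ C.depth := by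
  rw [Cell.size, Cell.size]
  exact pow_le_pow_iff_right_of_lt_one₀ (by norm_num) (by norm_num)

lemma Cell.two_mul_size_le {C D : Cell} (h : D.depth < C.depth) : 2 * C.size ≤ D.size := by
  have : C.size ≤ (1 / 2) ^ (D.depth + 1) :=
    pow_le_pow_of_le_one (by norm_num) (by norm_num) h
  rw [pow_succ] at this
  rw [Cell.size, Cell.size] at *
  linarith

lemma Quadtree.idx_lt (T : Quadtree) : ∀ (n : ℕ) (C : Cell), C.depth = n → C ∈ T.nodes →
    ∀ i, C.idx i + 1 ≤ 2 ^ C.depth := by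
  intro n
  induction n with
  | zero =>
    intro C hn hC i
    rcases T.has_parent C hC with rfl | ⟨D, -, b, rfl⟩
    · simp [Cell.root]
    · simp [Cell.child] at hn
  | succ n ih =>
    intro C hn hC i
    rcases T.has_parent C hC with rfl | ⟨D, hD, b, rfl⟩
    · simp [Cell.root]
    · have h1 := ih D (by simpa [Cell.child] using hn) hD i
      have h2 := (b i).isLt
      simp only [Cell.child, pow_succ]
      omega

lemma Quadtree.points_subset (T : Quadtree) {C : Cell} (hC : C ∈ T.nodes) :
    C.points ⊆ unitSquare := by
  intro x hx i
  obtain ⟨h1, h2⟩ := hx i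
  have hs := C.size_pos
  refine ⟨le_trans (by positivity) h1, ?_⟩
  rcases h2 with h2 | h2
  · refine h2.le.trans ?_
    have h3 : ((C.idx i : ℝ) + 1) ≤ 2 ^ C.depth := by
      exact_mod_cast T.idx_lt _ C rfl hC i
    calc ((C.idx i : ℝ) + 1) * C.size ≤ 2 ^ C.depth * C.size := by gcongr
      _ = 1 := by rw [Cell.size, ← mul_pow]; norm_num
  · exact h2.2.le

lemma Cell.points_child_subset (D : Cell) (b : Fin 2 → Fin 2) : (D.child b).points ⊆ D.points := by
  intro x hx i
  obtain ⟨h1, h2⟩ := hx i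
  have hs := D.size_pos
  have hsize : (D.child b).size = D.size / 2 := by
    simp only [Cell.size, Cell.child, pow_succ]; ring
  rw [hsize] at h1 h2
  have hb : ((b i : ℕ) : ℝ) ≤ 1 := by
    have := (b i).isLt
    exact_mod_cast (by omega : (b i : ℕ) ≤ 1)
  have hb0 : (0 : ℝ) ≤ ((b i : ℕ) : ℝ) := Nat.cast_nonneg _
  simp only [Cell.child, Nat.cast_add, Nat.cast_mul, Nat.cast_ofNat] at h1 h2
  constructor
  · nlinarith
  · rcases h2 with h2 | ⟨h2, h3⟩
    · left; nlinarith
    · right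
      refine ⟨?_, h3⟩
      have := (b i).isLt
      rw [pow_succ] at h2
      omega

/-- A node has an ancestor at each smaller depth. -/
lemma Quadtree.exists_ancestor (T : Quadtree) (d k : ℕ) : ∀ C ∈ T.nodes, C.depth = d + k →
    ∃ D ∈ T.nodes, D.depth = d ∧ C.points ⊆ D.points := by
  induction k with
  | zero => exact fun C hC h => ⟨C, hC, h, subset_rfl⟩
  | succ k ih =>
    intro C hC h
    rcases T.has_parent C hC with rfl | ⟨D, hD, b, rfl⟩
    · simp [Cell.root] at h
    · obtain ⟨E, hE, hd, hs⟩ := ih D hD (by simp only [Cell.child] at h; omega)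
      exact ⟨E, hE, hd, (D.points_child_subset b).trans hs⟩

/-! ### Boundary edges -/

/-- Reduces a boundary edge to an interval on a line: `i` is the constant coordinate, `j` the
running one, and the last clause keeps the vertices on that side out of the interior of the
interval. -/
lemma IsBoundaryEdge.spec {P : Set Plane} {a b : Plane} (h : IsBoundaryEdge P a b) :
    ∃ (i j : Fin 2) (c : ℝ), i ≠ j ∧ (c = 0 ∨ c = 1) ∧ midpoint ℝ a b i = c ∧
      dist (midpoint ℝ a b) a = |a j - b j| / 2 ∧ a i = c ∧ b i = c ∧
      midpoint ℝ a b j = (a j + b j) / 2 ∧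
      ∀ v ∈ P, v i = c → |a j - b j| / 2 ≤ |v j - midpoint ℝ a b j| := by
  obtain ⟨ha, hb, hne, ⟨i, hi⟩, hemp⟩ := h
  obtain ⟨c, hc, hai, hbi⟩ : ∃ c : ℝ, (c = 0 ∨ c = 1) ∧ a i = c ∧ b i = c := by
    rcases hi with ⟨h1, h2⟩ | ⟨h1, h2⟩
    · exact ⟨0, Or.inl rfl, h1, h2⟩
    · exact ⟨1, Or.inr rfl, h1, h2⟩
  obtain ⟨j, hij, hk⟩ : ∃ j : Fin 2, i ≠ j ∧ ∀ k, k = i ∨ k = j := by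
    fin_cases i
    · exact ⟨1, by decide, by decide⟩
    · exact ⟨0, by decide, by decide⟩
  have hmid : ∀ k, midpoint ℝ a b k = (a k + b k) / 2 := fun k => by
    simp [midpoint_eq_smul_add]; ring
  have hdist : ∀ x y : Plane, dist x y ^ 2 = (x i - y i) ^ 2 + (x j - y j) ^ 2 := fun x y => by
    rw [dist_sq_eq]
    fin_cases i <;> fin_cases j <;> first | exact absurd rfl hij | simp [add_comm]
  refine ⟨i, j, c, hij, hc, by rw [hmid, hai, hbi]; ring, ?_, hai, hbi, hmid j, fun v hv hvi => ?_⟩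
  · rw [← sq_eq_sq₀ dist_nonneg (by positivity), hdist, hmid, hmid, hai, hbi, div_pow, sq_abs]
    ring
  · by_contra! hcon
    have hjne : a j ≠ b j := fun h => by
      rw [h, sub_self, abs_zero, zero_div] at hcon
      exact absurd (abs_nonneg _) (not_le.2 hcon)
    rw [hmid] at hcon
    have hsub : b j - a j ≠ 0 := sub_ne_zero.2 hjne.symm
    have hprod : 0 < (v j - a j) * (b j - v j) := by
      have := sq_lt_sq' (by linarith [abs_nonneg (v j - (a j + b j) / 2), abs_nonneg (a j - b j)]) hcon
      rw [sq_abs, div_pow, sq_abs] at this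
      nlinarith
    have hs : 0 < (v j - a j) / (b j - a j) ∧ 0 < (b j - v j) / (b j - a j) := by
      rcases lt_or_gt_of_ne hsub with h | h
      · rcases pos_and_pos_or_neg_and_neg_of_mul_pos hprod with ⟨h1, h2⟩ | ⟨h1, h2⟩
        · linarith
        · exact ⟨div_pos_of_neg_of_neg h1 h, div_pos_of_neg_of_neg h2 h⟩
      · rcases pos_and_pos_or_neg_and_neg_of_mul_pos hprod with ⟨h1, h2⟩ | ⟨h1, h2⟩
        · exact ⟨div_pos h1 h, div_pos h2 h⟩
        · linarith
    refine hemp v hv ⟨_, _, hs.2, hs.1, by field_simp; ring, ?_⟩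
    ext k
    rcases hk k with rfl | rfl
    · simp only [PiLp.add_apply, PiLp.smul_apply, smul_eq_mul, hai, hbi, hvi]
      field_simp; ring
    · simp only [PiLp.add_apply, PiLp.smul_apply, smul_eq_mul]
      field_simp; ring

lemma abs_coord_sub_le_dist (x y : Plane) (i : Fin 2) : |x i - y i| ≤ dist x y := by
  rw [← sq_le_sq₀ (abs_nonneg _) dist_nonneg, sq_abs, dist_sq_eq]
  fin_cases i
  · simpa using sq_nonneg (x 1 - y 1)
  · simpa using sq_nonneg (x 0 - y 0)

lemma dist_eq_abs_of_coord_eq {x y : Plane} {i j : Fin 2} (hij : i ≠ j) (h : x i = y i) :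
    dist x y = |x j - y j| := by
  rw [← sq_eq_sq₀ dist_nonneg (abs_nonneg _), sq_abs, dist_sq_eq]
  fin_cases i <;> fin_cases j <;> first | exact absurd rfl hij | simp_all

/-- Two intervals without endpoints in the interior of each other are equal if their midpoints
are near each other. -/
lemma midpoint_eq_of_separated {a b a' b' : ℝ}
    (h1 : |a - b| / 2 ≤ |a' - (a + b) / 2|) (h2 : |a - b| / 2 ≤ |b' - (a + b) / 2|)
    (h3 : |a' - b'| / 2 ≤ |a - (a' + b') / 2|) (h4 : |a' - b'| / 2 ≤ |b - (a' + b') / 2|)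
    (_ : |(a + b) / 2 - (a' + b') / 2| < |a - b| / 2)
    (_ : |(a + b) / 2 - (a' + b') / 2| < |a' - b'| / 2) : (a + b) / 2 = (a' + b') / 2 := by
  grind

/-- Several midpoints may be inserted at once, and must not be too close to each other. On one side
of the square the edges have disjoint interiors; opposite sides are at distance `1`; for adjacent
sides the common corner is a vertex at least as close to `x` as `x'` is. -/
lemma infDist_le_or_infDist_le {P : Set Plane} (hsq : P ⊆ unitSquare)
    (hcor : ∀ c : Plane, (∀ i, c i = 0 ∨ c i = 1) → c ∈ P) {r x x' : Plane}
    (hx : x ∈ encroachedMidpoints P r) (hx' : x' ∈ encroachedMidpoints P r) (hne : x ≠ x') :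
    infDist x P ≤ dist x x' ∨ infDist x' P ≤ dist x x' := by
  obtain ⟨a, b, hab, -, rfl⟩ := hx
  obtain ⟨a', b', hab', -, rfl⟩ := hx'
  obtain ⟨i, j, c, hij, hc, hxi, hxa, hai, hbi, hxj, hemp⟩ := hab.spec
  obtain ⟨i', j', c', hij', hc', hxi', hxa', hai', hbi', hxj', hemp'⟩ := hab'.spec
  set x := midpoint ℝ a b
  set x' := midpoint ℝ a' b'
  have corner : ∀ d : ℝ, (d = 0 ∨ d = 1) → ∃ κ ∈ P, κ i = c ∧ κ j = d := by
    intro d hd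
    fin_cases i
    · have : j = 1 := by fin_cases j; exact absurd rfl hij; rfl
      subst this
      exact ⟨!₂[c, d], hcor _ (by intro k; fin_cases k; exacts [hc, hd]), rfl, rfl⟩
    · have : j = 0 := by fin_cases j; rfl; exact absurd rfl hij
      subst this
      exact ⟨!₂[d, c], hcor _ (by intro k; fin_cases k; exacts [hd, hc]), rfl, rfl⟩
  by_cases hii : i' = i
  · subst hii
    have hjj : j' = j := by omega
    subst hjj
    by_cases hcc : c' = c
    · subst hcc
      by_contra! hcon
      have h5 := hcon.1.trans_le ((infDist_le_dist_of_mem hab.1).trans_eq hxa)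
      have h6 := hcon.2.trans_le ((infDist_le_dist_of_mem hab'.1).trans_eq hxa')
      rw [dist_eq_abs_of_coord_eq hij (hxi.trans hxi'.symm), hxj, hxj'] at h5 h6
      have g1 := hemp a' hab'.1 hai'
      have g2 := hemp b' hab'.2.1 hbi'
      have g3 := hemp' a hab.1 hai
      have g4 := hemp' b hab.2.1 hbi
      rw [hxj] at g1 g2
      rw [hxj'] at g3 g4
      have := midpoint_eq_of_separated g1 g2 g3 g4 h5 h6
      apply hne
      rw [← dist_eq_zero, dist_eq_abs_of_coord_eq hij (hxi.trans hxi'.symm), hxj, hxj', this,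
        sub_self, abs_zero]
    · left
      obtain ⟨κ, hκ, hκi, hκj⟩ := corner 0 (Or.inl rfl)
      refine (infDist_le_dist_of_mem hκ).trans ?_
      have h1 : 1 ≤ dist x x' := by
        refine le_trans ?_ (abs_coord_sub_le_dist x x' i')
        rw [hxi, hxi']
        rcases hc with rfl | rfl <;> rcases hc' with rfl | rfl <;> simp at hcc ⊢
      refine le_trans ?_ h1
      rw [dist_eq_abs_of_coord_eq hij (hxi.trans hκi.symm), hκj, hxj, sub_zero]
      have ha := hsq hab.1 j'
      have hb := hsq hab.2.1 j'
      rw [abs_le]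
      constructor <;> linarith [ha.1, ha.2, hb.1, hb.2]
  · have hij2 : i' = j := by omega
    subst hij2
    left
    obtain ⟨κ, hκ, hκi, hκj⟩ := corner c' hc'
    refine (infDist_le_dist_of_mem hκ).trans ?_
    rw [dist_eq_abs_of_coord_eq hij (hxi.trans hκi.symm), hκj, ← hxi']
    exact abs_coord_sub_le_dist x x' i'

lemma encroachedMidpoints_finite {P : Set Plane} (hfin : P.Finite) (r : Plane) :
    (encroachedMidpoints P r).Finite := by
  refine ((hfin.prod hfin).image fun e => midpoint ℝ e.1 e.2).subset ?_
  rintro x ⟨a, b, h, -, rfl⟩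
  exact ⟨(a, b), ⟨h.1, h.2.1⟩, rfl⟩

/-! ### Initial vertices -/

lemma finite_boundaryVertices : boundaryVertices.Finite := by
  have hF : ({0, 1 / 3, 2 / 3, 1} : Set ℝ).Finite := by simp
  refine ((Set.Finite.pi' (ι := Fin 2) fun _ => hF).image fun f => (WithLp.toLp 2 f : Plane)).subset
    fun x hx => ⟨x.ofLp, hx.2, rfl⟩

lemma corner_mem_boundaryVertices {c : Plane} (h : ∀ i, c i = 0 ∨ c i = 1) :
    c ∈ boundaryVertices :=
  ⟨⟨0, h 0⟩, fun i => by rcases h i with h | h <;> simp [h]⟩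

/-- The local feature size of a vertex is the distance to the nearest other vertex. -/
lemma exists_dist_eq_lfs {P : Set Plane} (hfin : P.Finite) {u w : Plane} (hu : u ∈ P) (hw : w ∈ P)
    (hne : w ≠ u) : ∃ v ∈ P, v ≠ u ∧ lfs P u = dist u v ∧ ∀ x ∈ P, x ≠ u → dist u v ≤ dist u x := by
  obtain ⟨v, ⟨hv, hvu⟩, hmin⟩ := exists_min_image {x | x ∈ P ∧ x ≠ u} (fun x => dist u x)
    (hfin.subset fun x hx => hx.1) ⟨w, hw, hne⟩
  refine ⟨v, hv, hvu, ?_, fun x hx hxu => hmin x ⟨hx, hxu⟩⟩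
  have hmem : dist u v ∈ {ρ : ℝ | 0 ≤ ρ ∧ 2 ≤ (P ∩ closedBall u ρ).encard} := by
    refine ⟨dist_nonneg, ?_⟩
    rw [← encard_pair hvu]
    refine encard_le_encard (insert_subset ⟨hv, ?_⟩ (singleton_subset_iff.2 ⟨hu, ?_⟩))
    · rw [mem_closedBall']
    · exact mem_closedBall_self dist_nonneg
  refine le_antisymm (csInf_le ⟨0, fun ρ hρ => hρ.1⟩ hmem) (le_csInf ⟨_, hmem⟩ ?_)
  rintro ρ ⟨-, hρ⟩
  obtain ⟨x, ⟨hx, hxρ⟩, hxu⟩ := exists_ne_of_one_lt_encard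
    (lt_of_lt_of_le (by norm_num : (1 : ℕ∞) < 2) hρ) u
  exact (hmin x ⟨hx, hxu⟩).trans (mem_closedBall'.1 hxρ)

/-! ### The invariant of the algorithm -/

/-- The properties of the states of the algorithm on which the analysis rests. -/
structure Setup.Invariant (S : Setup) (s : RunState) : Prop where
  finite : s.P.Finite
  corner_mem : ∀ c : Plane, (∀ i, c i = 0 ∨ c i = 1) → c ∈ s.P
  loc_mem : ∀ u ∈ s.P, s.loc u ∈ S.tree.nodes ∧ u ∈ (s.loc u).points
  -- Only one alternative can be expected: a later vertex may come closer to an earlier one than the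
  -- storage cell of the latter suggests.
  le_dist : ∀ u ∈ s.P, ∀ v ∈ s.P, u ≠ v →
    S.cLow * (s.loc u).size ≤ dist u v ∨ S.cLow * (s.loc v).size ≤ dist u v
  exists_near : ∀ u ∈ s.P, ∃ v ∈ s.P, v ≠ u ∧ dist u v ≤ S.cUp * (s.loc u).size
  cur_mem : s.cur ∈ S.tree.nodes
  heap_subset : s.heap ⊆ S.tree.nodes
  depth_le : ∀ C ∈ s.heap, C.depth ≤ s.cur.depth
  mem_heap : ∀ C ∈ S.tree.nodes, C.depth < s.cur.depth → C ∈ s.heap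
  -- The second clause is what survives a change of level: once the current depth is exhausted, it
  -- yields the first clause for cells of twice the size.
  loose : ∀ u v, IsLeftLoose S.β s.P u v → S.cLow * s.cur.size ≤ dist u v ∧
    (2 * (S.cLow * s.cur.size) ≤ dist u v ∨
      ∃ C, (C ∈ s.heap ∨ C = s.cur) ∧ C.depth = s.cur.depth ∧ (u ∈ C.points ∨ v ∈ C.points))

/-- The assumptions on the parameters of the algorithm: vertices are active while nodes at most `K`
levels above their activation depth are handled. -/
structure Setup.Valid (S : Setup) (K : ℝ) : Prop where
  one_lt : 1 < S.β
  cLow_pos : 0 < S.cLow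
  two_mul_le : 2 * S.cLow ≤ S.cUp
  span : 2 * cGbu S.β * S.cUp ≤ 2 ^ K * S.cLow
  active : ∀ a i : ℕ, (a : ℝ) - K ≤ i → S.Active a i

lemma Setup.Invariant.subset_unitSquare {S : Setup} {s : RunState} (h : S.Invariant s) :
    s.P ⊆ unitSquare := fun u hu => S.tree.points_subset (h.loc_mem u hu).1 (h.loc_mem u hu).2

lemma Cell.size_lt_of_depth_sub {C D : Cell} {K : ℝ} (h : (D.depth : ℝ) < C.depth - K) :
    2 ^ K * C.size < D.size := by
  have e : ∀ C : Cell, C.size = (2 : ℝ) ^ (-(C.depth : ℝ)) := fun C => by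
    rw [Cell.size, Real.rpow_neg zero_le_two, Real.rpow_natCast, one_div, inv_pow]
  rw [e, e, ← Real.rpow_add zero_lt_two]
  exact Real.rpow_lt_rpow_of_exponent_lt one_lt_two (by linarith)

/-- Vertices of a much larger activation depth than the current node are not endpoints or
moonstruck points of loose pairs. -/
lemma Setup.Invariant.not_isLoosePair_and_not_isMoonstruck {S : Setup} {K : ℝ} (hS : S.Valid K)
    {s : RunState} (h : S.Invariant s) {p : Plane} (hp : p ∈ s.P)
    (hdepth : (s.cur.depth : ℝ) < s.act p - K) :
    (∀ q, ¬ IsLoosePair S.β s.P p q) ∧ (∀ q q', ¬ IsMoonstruck S.β s.P q q' p) := by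
  refine DelaunayRefinement.not_isLoosePair_and_not_isMoonstruck hS.one_lt h.finite
    h.subset_unitSquare hp (h.exists_near p hp) fun u v huv => lt_of_lt_of_le ?_ (h.loose u v huv).1
  have h1 : 2 ^ K * (s.loc p).size < s.cur.size := Cell.size_lt_of_depth_sub hdepth
  have h2 := (s.loc p).size_pos
  have h3 : 2 * cGbu S.β * S.cUp ≤ 2 ^ K * S.cLow := hS.span
  calc 2 * cGbu S.β * (S.cUp * (s.loc p).size) = 2 * cGbu S.β * S.cUp * (s.loc p).size := by ring
    _ ≤ 2 ^ K * S.cLow * (s.loc p).size := by gcongr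
    _ = S.cLow * (2 ^ K * (s.loc p).size) := by ring
    _ < S.cLow * s.cur.size := by have := hS.cLow_pos; gcongr

/-- Each vertex is stored in a leaf matching its local feature size, and the current cell is of
minimal size, so the bounds demanded of loose pairs hold for all pairs of vertices. -/
lemma Setup.IsInitial.invariant {S : Setup} {Ω : Set Plane} {s : RunState} (hΩ : Ω.Finite)
    (hLow : 0 < S.cLow) (hT : S.tree.Approximates (initialVertices Ω) S.cLow S.cUp)
    (h : S.IsInitial Ω s) : S.Invariant s := by
  obtain ⟨hP, hloc, hcur, hmin, hheap⟩ := h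
  have hfin : s.P.Finite := hP ▸ hΩ.union finite_boundaryVertices
  have hcor : ∀ c : Plane, (∀ i, c i = 0 ∨ c i = 1) → c ∈ s.P := fun c hc =>
    hP ▸ Or.inr (corner_mem_boundaryVertices hc)
  have hother : ∀ u : Plane, ∃ w ∈ s.P, w ≠ u := by
    intro u
    have h0 : (!₂[0, 0] : Plane) ∈ s.P := hcor _ (by intro i; fin_cases i <;> simp)
    have h1 : (!₂[1, 0] : Plane) ∈ s.P := hcor _ (by intro i; fin_cases i <;> simp)
    by_cases hu : (!₂[0, 0] : Plane) = u
    · refine ⟨_, h1, fun h => ?_⟩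
      have := congrArg (fun x : Plane => x 0) (hu.trans h.symm)
      simp at this
    · exact ⟨_, h0, hu⟩
  have hlfs : ∀ u ∈ s.P, S.cLow * (s.loc u).size ≤ lfs s.P u ∧ lfs s.P u ≤ S.cUp * (s.loc u).size :=
    fun u hu => hP ▸ hT _ (hloc u hu).1 u ⟨hP ▸ hu, (hloc u hu).2⟩
  have hdist : ∀ u ∈ s.P, ∀ v ∈ s.P, u ≠ v → S.cLow * (s.loc u).size ≤ dist u v := by
    intro u hu v hv hne
    obtain ⟨w, -, -, e, hw⟩ := exists_dist_eq_lfs hfin hu hv hne.symm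
    exact (hlfs u hu).1.trans (e ▸ hw v hv hne.symm)
  have hdepth : ∀ C ∈ S.tree.nodes, C.depth ≤ s.cur.depth := fun C hC =>
    Cell.size_le_iff.1 (hmin C hC)
  refine ⟨hfin, hcor, fun u hu => ⟨(hloc u hu).1.1, (hloc u hu).2⟩,
    fun u hu v hv hne => Or.inl (hdist u hu v hv hne), fun u hu => ?_, hcur,
    hheap ▸ sdiff_subset, fun C hC => hdepth C (hheap ▸ hC : C ∈ S.tree.nodes \ _).1,
    fun C hC hlt => ?_, fun u v huv => ?_⟩
  · obtain ⟨w, hw, hwu⟩ := hother u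
    obtain ⟨v, hv, hvu, e, -⟩ := exists_dist_eq_lfs hfin hu hw hwu
    exact ⟨v, hv, hvu, e ▸ (hlfs u hu).2⟩
  · rw [hheap]
    exact ⟨hC, by rintro rfl; exact lt_irrefl _ hlt⟩
  · have h1 := hdist u huv.1 v huv.2.1 huv.2.2.1
    have hn := (hloc u huv.1).1.1
    have h2 := hmin _ hn
    refine ⟨(mul_le_mul_of_nonneg_left h2 hLow.le).trans h1, ?_⟩
    rcases (hdepth _ hn).lt_or_eq with hlt | heq
    · left
      have := mul_le_mul_of_nonneg_left (Cell.two_mul_size_le hlt) hLow.le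
      linarith
    · right
      refine ⟨s.loc u, ?_, heq, Or.inl (hloc u huv.1).2⟩
      by_cases hc : s.loc u = s.cur
      · exact Or.inr hc
      · exact Or.inl (hheap ▸ ⟨hn, hc⟩)

/-! ### Preservation of the invariant -/

lemma IsLeftLoose.mono {β : ℝ} {P Q : Set Plane} (hPQ : P ⊆ Q) {u v : Plane} (hu : u ∈ P)
    (hv : v ∈ P) (h : IsLeftLoose β Q u v) : IsLeftLoose β P u v :=
  ⟨hu, hv, h.2.2.1, h.2.2.2.1, fun x hx => h.2.2.2.2 x (hPQ hx)⟩

/-- Adding vertices preserves the invariant if they are stored according to the distance to the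
nearest vertex. -/
lemma Setup.Invariant.adds {S : Setup} {s t : RunState} {N : Set Plane} {δ : Plane → ℝ}
    (hLow : 0 < S.cLow) (h : S.Invariant s) (hN : N.Finite)
    (hold : ∀ x ∈ N, ∀ v ∈ s.P, δ x ≤ dist x v)
    (hnear : ∀ x ∈ N, ∃ v ∈ s.P, dist x v ≤ δ x)
    (hnew : ∀ x ∈ N, ∀ x' ∈ N, x ≠ x' → δ x ≤ dist x x' ∨ δ x' ≤ dist x x')
    (ht : S.Adds s t N δ) : S.Invariant t := by
  obtain ⟨hP, hloc, hst, hheap, hcur⟩ := ht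
  have hsub : s.P ⊆ t.P := hP ▸ subset_union_left
  have hmem : ∀ u ∈ t.P, u ∉ s.P → u ∈ N := fun u hu hn => (hP ▸ hu : u ∈ s.P ∪ N).resolve_left hn
  have hfar : ∀ u ∈ t.P, ∀ v ∈ t.P, u ≠ v → ¬ (u ∈ s.P ∧ v ∈ s.P) →
      ∃ w ∈ N, (w = u ∨ w = v) ∧ S.cLow * (t.loc w).size ≤ dist u v := by
    intro u hu v hv hne hn
    obtain ⟨w, hw, hwe, hd⟩ : ∃ w ∈ N, (w = u ∨ w = v) ∧ δ w ≤ dist u v := by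
      by_cases hus : u ∈ s.P
      · have hvN := hmem v hv fun hvs => hn ⟨hus, hvs⟩
        exact ⟨v, hvN, Or.inr rfl, dist_comm v u ▸ hold v hvN u hus⟩
      · have huN := hmem u hu hus
        by_cases hvs : v ∈ s.P
        · exact ⟨u, huN, Or.inl rfl, hold u huN v hvs⟩
        · have hvN := hmem v hv hvs
          rcases hnew u huN v hvN hne with hd | hd
          · exact ⟨u, huN, Or.inl rfl, hd⟩
          · exact ⟨v, hvN, Or.inr rfl, hd⟩
    exact ⟨w, hw, hwe, (hst w hw).1.2.2.1.trans hd⟩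
  refine ⟨hP ▸ h.finite.union hN, fun c hc => hsub (h.corner_mem c hc), fun u hu => ?_,
    fun u hu v hv hne => ?_, fun u hu => ?_, hcur ▸ h.cur_mem, ?_, ?_, ?_, fun u v huv => ?_⟩
  · by_cases hus : u ∈ s.P
    · rw [hloc u hus]; exact h.loc_mem u hus
    · have := (hst u (hmem u hu hus)).1
      exact ⟨this.1, this.2.1⟩
  · by_cases hs : u ∈ s.P ∧ v ∈ s.P
    · rw [hloc u hs.1, hloc v hs.2]; exact h.le_dist u hs.1 v hs.2 hne
    · obtain ⟨w, -, rfl | rfl, hd⟩ := hfar u hu v hv hne hs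
      · exact Or.inl hd
      · exact Or.inr hd
  · by_cases hus : u ∈ s.P
    · obtain ⟨v, hv, hvu, hd⟩ := h.exists_near u hus
      exact ⟨v, hsub hv, hvu, by rwa [hloc u hus]⟩
    · have huN := hmem u hu hus
      obtain ⟨v, hv, hd⟩ := hnear u huN
      exact ⟨v, hsub hv, fun e => hus (e ▸ hv), hd.trans (hst u huN).1.2.2.2.1⟩
  · rw [hheap]
    rintro C (hC | ⟨-, x, hx, rfl⟩)
    · exact h.heap_subset hC
    · exact (hst x hx).1.1
  · rw [hheap, hcur]
    rintro C (hC | ⟨hC, -⟩)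
    · exact h.depth_le C hC
    · exact hC.le
  · rw [hheap, hcur]
    exact fun C hC hlt => Or.inl (h.mem_heap C hC hlt)
  · rw [hcur]
    by_cases hs : u ∈ s.P ∧ v ∈ s.P
    · obtain ⟨h1, h2⟩ := h.loose u v (huv.mono hsub hs.1 hs.2)
      refine ⟨h1, h2.imp_right ?_⟩
      rintro ⟨C, hC, hd⟩
      exact ⟨C, hC.imp_left fun hC => hheap ▸ Or.inl hC, hd⟩
    -- A new endpoint is stored in a cell at least as large as the current one: either at the
    -- current depth, hence back in the heap, or at least twice as large, which makes the pair long.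
    · obtain ⟨w, hw, hwe, hd⟩ := hfar u huv.1 v huv.2.1 huv.2.2.1 hs
      obtain ⟨-, hwC, -, -, hsize⟩ := (hst w hw).1
      refine ⟨(mul_le_mul_of_nonneg_left hsize hLow.le).trans hd, ?_⟩
      rcases (Cell.size_le_iff.1 hsize).lt_or_eq with hlt | heq
      · left
        have := mul_le_mul_of_nonneg_left (Cell.two_mul_size_le hlt) hLow.le
        linarith
      · right
        refine ⟨t.loc w, Or.inl (hheap ▸ Or.inr ⟨heq, w, hw, rfl⟩), heq, ?_⟩
        rcases hwe with rfl | rfl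
        · exact Or.inl hwC
        · exact Or.inr hwC

/-- When a node has been dealt with, it contains no endpoint of a short loose pair. -/
lemma Setup.Invariant.not_mem_cur {S : Setup} {K : ℝ} (hS : S.Valid K) {s : RunState}
    (h : S.Invariant s) (hdone : ∀ p q, ¬ S.IsCandidate s p q) {u v : Plane}
    (huv : IsLoosePair S.β s.P u v) (hu : u ∈ s.P) (hv : v ∈ s.P)
    (hlt : dist u v < 2 * (S.cLow * s.cur.size)) : u ∉ s.cur.points := by
  intro hcur
  -- An endpoint of a loose pair cannot be much deeper than the current cell, by the claim for the
  -- state `s` itself; so it is active.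
  have hact : ∀ {u v}, u ∈ s.P → IsLoosePair S.β s.P u v → S.Active (s.act u) s.cur.depth := by
    intro u v hu huv
    refine hS.active _ _ (not_lt.1 fun hlt => ?_)
    exact (h.not_isLoosePair_and_not_isMoonstruck hS hu hlt).1 v huv
  refine hdone u v ⟨hu, hcur, hact hu huv, hv, hact hv huv.symm, hlt.le.trans ?_, huv⟩
  have h1 := one_le_cGbu hS.one_lt
  have h2 := hS.two_mul_le
  have h3 := hS.cLow_pos
  have h4 : S.cUp ≤ S.cUp * cGbu S.β := le_mul_of_one_le_right (by linarith) h1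
  have h5 : 2 * S.cLow ≤ cReach S.β S.cUp := by rw [cReach]; linarith
  calc 2 * (S.cLow * s.cur.size) = 2 * S.cLow * s.cur.size := by ring
    _ ≤ _ := mul_le_mul_of_nonneg_right h5 s.cur.size_pos.le

/-- The finished cell contains no endpoint of a short loose pair. If `C` has the same depth, the
remaining cells in the heap account for the short pairs. If `C` is one level higher, the finished
depth is exhausted, so all loose pairs have length at least `2 * cLow * s.cur.size = cLow * C.size`.
-/
lemma Setup.Invariant.extract {S : Setup} {K : ℝ} (hS : S.Valid K) {s : RunState}
    (h : S.Invariant s) (hdone : ∀ p q, ¬ S.IsCandidate s p q) {C : Cell} (hC : C ∈ s.heap)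
    (hmin : ∀ D ∈ s.heap, C.size ≤ D.size) : S.Invariant ⟨s.P, s.loc, s.heap \ {C}, C⟩ := by
  have hLow := hS.cLow_pos
  have hle := h.depth_le C hC
  refine ⟨h.finite, h.corner_mem, h.loc_mem, h.le_dist, h.exists_near, h.heap_subset hC,
    sdiff_subset.trans h.heap_subset, fun D hD => Cell.size_le_iff.1 (hmin D hD.1),
    fun D hD hlt => ?_, fun u v huv => ?_⟩
  · exact ⟨h.mem_heap D hD (lt_of_lt_of_le hlt hle), by rintro rfl; exact lt_irrefl _ hlt⟩
  have hu := huv.1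
  have hv := huv.2.1
  obtain ⟨h1, h2⟩ := h.loose u v huv
  have h3 : 2 * (S.cLow * s.cur.size) ≤ dist u v ∨
      ∃ D ∈ s.heap, D.depth = s.cur.depth ∧ (u ∈ D.points ∨ v ∈ D.points) := by
    by_contra! hc
    rcases h2 with h2 | ⟨D, hD | rfl, hDd, hDp⟩
    · exact not_le.2 hc.1 h2
    · have := hc.2 D hD hDd
      tauto
    · rcases hDp with hDp | hDp
      · exact h.not_mem_cur hS hdone (Or.inl huv) hu hv hc.1 hDp
      · exact h.not_mem_cur hS hdone (Or.inr huv) hv hu (dist_comm u v ▸ hc.1) hDp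
  rcases hle.lt_or_eq with hlt | heq
  -- The parent of the current cell is still in the heap, so the depth drops by exactly one.
  · have hdepth : s.cur.depth = C.depth + 1 := by
      obtain ⟨D, hD, hDd, -⟩ := S.tree.exists_ancestor (s.cur.depth - 1) 1 s.cur h.cur_mem
        (by omega)
      have := Cell.size_le_iff.1 (hmin D (h.mem_heap D hD (by omega)))
      omega
    have hsize : C.size = 2 * s.cur.size := by
      rw [Cell.size, Cell.size, hdepth, pow_succ]; ring
    have hfar : S.cLow * C.size ≤ dist u v := by
      rcases h3 with h3 | ⟨D, hD, hDd, -⟩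
      · rw [hsize]; linarith
      · have := Cell.size_le_iff.1 (hmin D hD)
        omega
    refine ⟨hfar, ?_⟩
    -- At the new level the pending cell comes from `le_dist`: if the storage cell of the endpoint
    -- is above this level, the pair is long, and otherwise the ancestor of that cell at this level
    -- has not been handled yet.
    have hstored : ∀ w ∈ s.P, S.cLow * (s.loc w).size ≤ dist u v →
        2 * (S.cLow * C.size) ≤ dist u v ∨
          ∃ D, (D ∈ s.heap \ {C} ∨ D = C) ∧ D.depth = C.depth ∧ w ∈ D.points := by
      intro w hw hd
      obtain ⟨hn, hwp⟩ := h.loc_mem w hw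
      rcases lt_or_ge (s.loc w).depth C.depth with hlt' | hge
      · left
        have := mul_le_mul_of_nonneg_left (Cell.two_mul_size_le hlt') hLow.le
        linarith
      · right
        obtain ⟨D, hD, hDd, hsub⟩ := S.tree.exists_ancestor C.depth ((s.loc w).depth - C.depth)
          _ hn (by omega)
        refine ⟨D, ?_, hDd, hsub hwp⟩
        by_cases hDC : D = C
        · exact Or.inr hDC
        · exact Or.inl ⟨h.mem_heap D hD (by omega), hDC⟩
    rcases h.le_dist u hu v hv huv.2.2.1 with hd | hd
    · refine (hstored u hu hd).imp_right ?_
      rintro ⟨D, hD, hDd, hDp⟩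
      exact ⟨D, hD, hDd, Or.inl hDp⟩
    · refine (hstored v hv hd).imp_right ?_
      rintro ⟨D, hD, hDd, hDp⟩
      exact ⟨D, hD, hDd, Or.inr hDp⟩
  · have hsize : C.size = s.cur.size := by rw [Cell.size, Cell.size, heq]
    change S.cLow * C.size ≤ dist u v ∧ (2 * (S.cLow * C.size) ≤ dist u v ∨ _)
    rw [hsize]
    refine ⟨h1, h3.imp_right ?_⟩
    rintro ⟨D, hD, hDd, hDp⟩
    refine ⟨D, ?_, hDd.trans heq.symm, hDp⟩
    by_cases hDC : D = C
    · exact Or.inr hDC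
    · exact Or.inl ⟨hD, hDC⟩

lemma Setup.Invariant.step {S : Setup} {K : ℝ} (hS : S.Valid K) {s t : RunState}
    (h : S.Invariant s) (hst : S.Step s t) : S.Invariant t := by
  cases hst with
  | insert _ p q r hpq hr he ht =>
    have hempty := hr.isEmptyCenter
    refine h.adds hS.cLow_pos (finite_singleton r) ?_ ?_ ?_ ht
    · rintro x rfl v hv
      rw [dist_comm p]
      exact hempty.2 v hv
    · rintro x rfl
      exact ⟨p, hpq.1, (dist_comm x p).le⟩
    · rintro x rfl x' rfl hne
      exact absurd rfl hne
  | split _ p q r hpq hr he ht =>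
    refine h.adds hS.cLow_pos (encroachedMidpoints_finite h.finite r) ?_ ?_ ?_ ht
    · exact fun x _ v hv => infDist_le_dist_of_mem hv
    · intro x _
      obtain ⟨v, hv, e⟩ := h.finite.isCompact.exists_infDist_eq_dist ⟨p, hpq.1⟩ x
      exact ⟨v, hv, e.ge⟩
    · exact fun x hx x' hx' hne =>
        infDist_le_or_infDist_le h.subset_unitSquare h.corner_mem hx hx' hne
  | extract C hdone hC hmin => exact h.extract hS hdone hC hmin

lemma Setup.Reachable.invariant {S : Setup} {K : ℝ} (hS : S.Valid K) {Ω : Set Plane}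
    (hΩ : Ω.Finite) (hT : S.tree.Approximates (initialVertices Ω) S.cLow S.cUp) {s : RunState}
    (h : S.Reachable Ω s) : S.Invariant s := by
  obtain ⟨s₀, h₀, hs⟩ := h
  induction hs with
  | refl => exact h₀.invariant hΩ hS.cLow_pos hT
  | tail _ hstep ih => exact ih.step hS hstep

/-- The summand `1` in `cSpan` provides the factor `2` needed for moonstruck points; dividing by
`cShrink ≤ 1` only enlarges the span. -/
lemma Setup.valid_cSpan {β cLow cUp cShrink : ℝ} {T : Quadtree} {Active : ℕ → ℕ → Prop}
    (hβ : 1 < β) (hLow : 0 < cLow) (hUp : 2 * cLow ≤ cUp) (hShrink : 0 < cShrink)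
    (hShrink1 : cShrink ≤ 1)
    (hActive : ∀ a i : ℕ, (a : ℝ) - cSpan β cLow cUp cShrink ≤ i → Active a i) :
    (Setup.mk β cLow cUp T Active).Valid (cSpan β cLow cUp cShrink) := by
  refine ⟨hβ, hLow, hUp, ?_, hActive⟩
  have hg := one_le_cGbu hβ
  have hcUp : 0 < cUp := by linarith
  have hpos : 0 < cGbu β * cUp / (cShrink * cLow) := by positivity
  have hpow : (2 : ℝ) ^ cSpan β cLow cUp cShrink = 2 * (cGbu β * cUp / (cShrink * cLow)) := by
    rw [cSpan, Real.rpow_add zero_lt_two, Real.rpow_logb zero_lt_two (by norm_num) hpos,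
      Real.rpow_one, mul_comm]
  have e : 2 ^ cSpan β cLow cUp cShrink * cLow = 2 * cGbu β * cUp / cShrink := by
    rw [hpow]; field_simp
  change 2 * cGbu β * cUp ≤ 2 ^ cSpan β cLow cUp cShrink * cLow
  rw [e, le_div_iff₀ hShrink]
  exact mul_le_of_le_one_right (by positivity) hShrink1

end DelaunayRefinement

end

open DelaunayRefinement in
theorem mainTheorem5 (β : ℝ) (hβ : √2 ≤ β)
    (Ω : Set Plane) (hΩfin : Ω.Finite) (hΩ : ∀ x ∈ Ω, ∀ i, x i ∈ Set.Icc (1 / 3 : ℝ) (2 / 3))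
    (T : Quadtree) (hbal : T.Balanced)
    (cLow cUp cShrink : ℝ) (hLow : 0 < cLow) (hUp : 2 * cLow ≤ cUp)
    (hShrink : 0 < cShrink) (hShrink1 : cShrink ≤ 1)
    (hT : T.Approximates (initialVertices Ω) cLow cUp)
    (Active : ℕ → ℕ → Prop)
    (hActive : ∀ a i : ℕ, (a : ℝ) - cSpan β cLow cUp cShrink ≤ i → Active a i)
    (s : RunState) (hs : (Setup.mk β cLow cUp T Active).Reachable Ω s)
    (p : Plane) (hp : p ∈ s.P)
    (hdepth : (s.cur.depth : ℝ) < s.act p - cSpan β cLow cUp cShrink) :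
    (∀ q, ¬ IsLoosePair β s.P p q) ∧ (∀ q q', ¬ IsMoonstruck β s.P q q' p) := by
  have hS := Setup.valid_cSpan (T := T) (one_lt_of_sqrt_two_le hβ) hLow hUp hShrink hShrink1 hActive
  exact (hs.invariant hS hΩfin hT).not_isLoosePair_and_not_isMoonstruck hS hp hdepth
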